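/- Let $n\ge 1$, $m\ge 0$, let $X\subset\mathbb R^n$ be compact and convex, let $f_1,\dots,f_n:\mathbb R\to\mathbb R$ and $g_1,\dots,g_m:\mathbb R^n\to\mathbb R$ be convex and $C^2$, and suppose that there is $\bar x\in X$ with $g_j(\bar x)<0$ for all $j$. Put $f(x)=\sum_i f_i(x_i)$, $g=(g_1,\dots,g_m)$ and $L(x,\mu)=f(x)+\mu^Tg(x)$. A saddle point of $L$ is a pair $(x^*,\mu^*)\in X\times\mathbb R^m_+$ with $L(x^*,\mu)\le L(x^*,\mu^*)\le L(x,\mu^*)$ for all $x\in X$, $\mu\in\mathbb R^m_+$. Assume that $f$ has a unique minimizer $\hat x$ over $\{x\in X: g(x)\le 0\}$ and that either $\hat x$ lies in the interior of $X$ and is a regular point of $g$ (the gradients of the constraints that are active at $\hat x$ are linearly independent), or $L$ has at most one saddle point. Let $\bar\gamma,\bar\alpha>0$, $0<c_2<c_1$, $c_1+c_2<1$, and let $\gamma(k)=\bar\gamma k^{-c_1}$, $\alpha(k)=\bar\alpha k^{-c_2}$ for $k\ge1$, with arbitrary real values $\gamma(0)$, $\alpha(0)$. Let $x(0)\in X$,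 $\mu(0)\in\mathbb R^m$ be deterministic and consider $$x(k+1)=P_X\Big[\Big(x_i(k)-\gamma(k)\big(f_i'(x_i(k))+\big(\tfrac{\partial g}{\partial x_i}(x(k))+w_i(k)\big)^T\mu(k)+\alpha(k)x_i(k)\big)\Big)_{i=1}^n\Big],$$ $$\mu(k+1)=\big[\mu(k)+\gamma(k)\big(g(x(k))+w_g(k)-\alpha(k)\mu(k)\big)\big]_+,$$ where $P_X$ is the Euclidean projection onto $X$, $[\cdot]_+$ is the projection onto $\mathbb R^m_+$, $w_i(k)\sim\mathcal N(0,\sigma_i(k)^2I_m)$, $w_g(k)\sim\mathcal N(0,\sigma_g(k)^2I_m)$, and the families $(w_g(k),w_1(k),\dots,w_n(k))$ are independent for different $k$. (Constant standard deviations $\sigma_i,\sigma_g$ are a special case.) Let $\epsilon>0$, $0<\delta<1$, $b\in\mathbb R^n$ with $b_i\ge 0$, $B=\max_i b_i$, and $\kappa(\delta,\epsilon)=\frac1{2\epsilon}\big(K_\delta+\sqrt{K_\delta^2+2\epsilon}\big)$ with $K_\delta=\mathcal Q^{-1}(\delta)$, $\mathcal Q(t)=\frac1{\sqrt{2\pi}}\int_t^\infty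 e^{-u^2/2}\,du$. Let $K^i_{g'}$ and $K_g$ be Lipschitz constants of $\frac{\partial g}{\partial x_i}$ and $g$ on $X$ (Euclidean norms). Assume that for all $i,k$ $$\kappa(\delta,\epsilon)K^i_{g'}B\le\sigma_i(k)\le\sigma_{\max},\qquad \kappa(\delta,\epsilon)K_gB\le\sigma_g(k)\le\sigma_{\max}$$ for some $\sigma_{\max}<\infty$. Two signals $u,\tilde u:\mathbb N\to X$ are called adjacent if for some $i$ we have $\big(\sum_k|u_i(k)-\tilde u_i(k)|^2\big)^{1/2}\le b_i$ and $u_j=\tilde u_j$ for all $j\ne i$. A mechanism $M$, which maps signals $\mathbb N\to X$ to random sequences in $\mathbb R^m$, is called $(\epsilon,\delta)$-differentially private if for all adjacent $u,\tilde u$, all $k\ge0$ and all Borel sets $S\subset\mathbb R^{(k+1)m}$, $$\mathbb P\big((Mu)_{0:k}\in S\big)\le e^\epsilon\,\mathbb P\big((M\tilde u)_{0:k}\in S\big)+\delta .$$ Then the following hold simultaneously. 1. $L$ has exactly one saddle point, it is of the form $(\hat x,\hat\mu)$, all $x(k)$ and $\mu(k)$ are square integrable, and $\mathbb E\|x(k)-\hat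 x\|_2^2\to0$ and $\mathbb E\|\mu(k)-\hat\mu\|_2^2\to0$ as $k\to\infty$. 2. If $X=\prod_iY_i$ is a product, then the update of $x$ can be carried out by each agent separately: $x_i(k+1)=P_{Y_i}\big[x_i(k)-\gamma(k)\big(f_i'(x_i(k))+(\frac{\partial g}{\partial x_i}(x(k))+w_i(k))^T\mu(k)+\alpha(k)x_i(k)\big)\big]$ for all $i$ and $k$. 3. Each of the mechanisms by which the cloud releases information about the agents' states $x$ is $(\epsilon,\delta)$-differentially private: $x\mapsto\big(\frac{\partial g}{\partial x_i}(x(k))+w_i(k)\big)_{k\ge0}$ for every $i$; $x\mapsto\big(g(x(k))+w_g(k)\big)_{k\ge0}$; and the mechanism that maps a signal $x$ to the multipliers $(\mu(k))_{k\ge0}$ computed from it by the above recursion for $\mu$ with the given $\mu(0)$. -/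

import Mathlib

open MeasureTheory ProbabilityTheory Filter Topology
open scoped NNReal ENNReal

noncomputable section

namespace PrivOpt

/-- Euclidean space `ℝᵈ`. -/
abbrev Vec (d : ℕ) : Type := EuclideanSpace ℝ (Fin d)

/-! ### The optimization problem -/

/-- The constraint vector `g(x) = (g₁(x), …, gₘ(x))`. -/
def constraintVec {n m : ℕ} (g : Fin m → Vec n → ℝ) (x : Vec n) : Vec m :=
  WithLp.toLp 2 fun j => g j x

/-- The partial derivative `∂g/∂xᵢ (x) ∈ ℝᵐ` of the constraint vector. -/
def constraintPartial {n m : ℕ} (g : Fin m → Vec n → ℝ) (i : Fin n) (x : Vec n) : Vec m :=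
  WithLp.toLp 2 fun j => fderiv ℝ (g j) x (EuclideanSpace.single i 1)

/-- The global objective `f(x) = ∑ᵢ fᵢ(xᵢ)`. -/
def objective {n : ℕ} (f : Fin n → ℝ → ℝ) (x : Vec n) : ℝ := ∑ i, f i (x i)

/-- The Lagrangian `L(x, μ) = f(x) + μᵀ g(x)`. -/
def lagrangian {n m : ℕ} (f : Fin n → ℝ → ℝ) (g : Fin m → Vec n → ℝ)
    (x : Vec n) (μ : Vec m) : ℝ :=
  objective f x + ∑ j, μ j * g j x

/-- `(xs, μs)` is a saddle point of the Lagrangian over `X × ℝᵐ₊`. -/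
structure IsSaddlePoint {n m : ℕ} (X : Set (Vec n)) (f : Fin n → ℝ → ℝ)
    (g : Fin m → Vec n → ℝ) (xs : Vec n) (μs : Vec m) : Prop where
  primal_mem : xs ∈ X
  dual_nonneg : ∀ j, 0 ≤ μs j
  le_dual : ∀ μ : Vec m, (∀ j, 0 ≤ μ j) → lagrangian f g xs μ ≤ lagrangian f g xs μs
  le_primal : ∀ x ∈ X, lagrangian f g xs μs ≤ lagrangian f g x μs

/-- The feasible set `{x ∈ X : g(x) ≤ 0}`. -/
def feasibleSet {n m : ℕ} (X : Set (Vec n)) (g : Fin m → Vec n → ℝ) : Set (Vec n) :=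
  {x | x ∈ X ∧ ∀ j, g j x ≤ 0}

/-- `xs` is the unique constrained minimum of `f`. -/
def IsUniqueConstrainedMin {n m : ℕ} (X : Set (Vec n)) (f : Fin n → ℝ → ℝ)
    (g : Fin m → Vec n → ℝ) (xs : Vec n) : Prop :=
  xs ∈ feasibleSet X g ∧ ∀ x ∈ feasibleSet X g, x ≠ xs → objective f xs < objective f x

/-- `xs` is a regular point of the constraints: the gradients of the constraints that are active
at `xs` are linearly independent. -/
def IsRegularPoint {n m : ℕ} (g : Fin m → Vec n → ℝ) (xs : Vec n) : Prop :=
  LinearIndependent ℝ fun j : {j : Fin m // g j xs = 0} => gradient (g j) xs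

/-! ### The algorithm in the cloud architecture -/

open Classical in
/-- The Euclidean projection onto `X`: a point of `X` closest to `y`. It exists and is unique when
`X` is nonempty, closed and convex, the only case in which it is used. -/
def proj {E : Type*} [NormedAddCommGroup E] (X : Set E) (y : E) : E :=
  if h : ∃ p ∈ X, ∀ q ∈ X, ‖y - p‖ ≤ ‖y - q‖ then h.choose else y

/-- The sequence `k ↦ a k^(-c)` for `k ≥ 1`, with an arbitrary value `v₀` at `k = 0`, where the
formula makes no sense. -/
def powerSeq (v₀ a c : ℝ) (k : ℕ) : ℝ := if k = 0 then v₀ else a * (k : ℝ) ^ (-c)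

/-- The value `G(x) = g(x) + v` of the constraints, perturbed by the noise `v`. -/
def noisyConstraint {n m : ℕ} (g : Fin m → Vec n → ℝ) (x : Vec n) (v : Vec m) : Vec m :=
  constraintVec g x + v

/-- The value `∂_{xᵢ}G(x) = ∂g/∂xᵢ(x) + v` sent to agent `i`, perturbed by the noise `v`. -/
def noisyPartial {n m : ℕ} (g : Fin m → Vec n → ℝ) (i : Fin n) (x : Vec n) (v : Vec m) : Vec m :=
  constraintPartial g i x + v

/-- What an agent with state `xi` and objective `fi` computes before projecting, from the received
partial derivative `dG` and multiplier `μ`: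
`xi - γ (fi'(xi) + dGᵀ μ + α xi)`. -/
def agentStep {m : ℕ} (γ α : ℝ) (fi : ℝ → ℝ) (xi : ℝ) (dG μ : Vec m) : ℝ :=
  xi - γ * (deriv fi xi + inner ℝ dG μ + α * xi)

/-- The update `[μ + γ (G - α μ)]₊` of the multipliers in the cloud. -/
def cloudStep {m : ℕ} (γ α : ℝ) (μ G : Vec m) : Vec m :=
  WithLp.toLp 2 fun j => max (μ j + γ * (G j - α * μ j)) 0

/-- The iterates `(x(k), μ(k))` of the noisy primal-dual algorithm, for step sizes `γ`,
regularization weights `α` and a realization `w`, `wg` of the noises. -/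
def iterates {n m : ℕ} (X : Set (Vec n)) (f : Fin n → ℝ → ℝ) (g : Fin m → Vec n → ℝ)
    (γ α : ℕ → ℝ) (x₀ : Vec n) (μ₀ : Vec m) (w : Fin n → ℕ → Vec m) (wg : ℕ → Vec m) :
    ℕ → Vec n × Vec m
  | 0 => (x₀, μ₀)
  | k + 1 =>
    let x := (iterates X f g γ α x₀ μ₀ w wg k).1
    let μ := (iterates X f g γ α x₀ μ₀ w wg k).2
    (proj X (WithLp.toLp 2 fun i =>
        agentStep (γ k) (α k) (f i) (x i) (noisyPartial g i x (w i k)) μ),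
      cloudStep (γ k) (α k) μ (noisyConstraint g x (wg k)))

/-! ### Differential privacy of dynamical systems -/

/-- Two signals of network states are adjacent if they differ in the signal of at most one agent
`i`, and there by at most `b i` in the `ℓ₂` norm. -/
def Adjacent {n : ℕ} (b : Fin n → ℝ) (u v : ℕ → Vec n) : Prop :=
  ∃ i, (Summable fun k => (u k i - v k i) ^ 2) ∧ √(∑' k, (u k i - v k i) ^ 2) ≤ b i ∧
    ∀ j, j ≠ i → ∀ k, u k j = v k j

/-- The mechanism `M`, whose inputs are the signals with values in `X`, is
`(ε, δ)`-differentially private: for adjacent inputs, the laws of the output truncated to the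
times `0, …, k` are `(ε, δ)`-close, for every `k`. -/
def IsDiffPrivate {n : ℕ} {Ω F : Type*} [MeasurableSpace Ω] [MeasurableSpace F] (P : Measure Ω)
    (X : Set (Vec n)) (b : Fin n → ℝ) (ε δ : ℝ) (M : (ℕ → Vec n) → Ω → ℕ → F) : Prop :=
  ∀ u v : ℕ → Vec n, (∀ k, u k ∈ X) → (∀ k, v k ∈ X) → Adjacent b u v →
    ∀ (k : ℕ) (S : Set (Fin (k + 1) → F)), MeasurableSet S →
      P {ω | (fun t : Fin (k + 1) => M u ω t) ∈ S} ≤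
        ENNReal.ofReal (Real.exp ε) * P {ω | (fun t : Fin (k + 1) => M v ω t) ∈ S} +
          ENNReal.ofReal δ

/-- The Gaussian tail function `𝒬`. -/
def gaussianTail (x : ℝ) : ℝ := 1 / √(2 * Real.pi) * ∫ u in Set.Ioi x, Real.exp (-u ^ 2 / 2)

/-- `κ(δ, ε) = (K + √(K² + 2ε)) / (2ε)` with `K = 𝒬⁻¹(δ)`. -/
def kappa (δ ε : ℝ) : ℝ :=
  1 / (2 * ε) * (Function.invFun gaussianTail δ + √(Function.invFun gaussianTail δ ^ 2 + 2 * ε))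

/-- The mechanism `x ↦ ∂g/∂xᵢ(x(k)) + wᵢ(k)`. -/
def partialMechanism {n m : ℕ} {Ω : Type*} (g : Fin m → Vec n → ℝ) (i : Fin n)
    (wi : ℕ → Ω → Vec m) (u : ℕ → Vec n) (ω : Ω) (k : ℕ) : Vec m :=
  noisyPartial g i (u k) (wi k ω)

/-- The mechanism `x ↦ g(x(k)) + w_g(k)`. -/
def constraintMechanism {n m : ℕ} {Ω : Type*} (g : Fin m → Vec n → ℝ)
    (wg : ℕ → Ω → Vec m) (u : ℕ → Vec n) (ω : Ω) (k : ℕ) : Vec m :=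
  noisyConstraint g (u k) (wg k ω)

/-- The mechanism that turns a signal of network states into the multipliers that the cloud computes
from it and sends to the agents. -/
def multiplierMechanism {n m : ℕ} {Ω : Type*} (g : Fin m → Vec n → ℝ) (γ α : ℕ → ℝ) (μ₀ : Vec m)
    (wg : ℕ → Ω → Vec m) (u : ℕ → Vec n) (ω : Ω) : ℕ → Vec m
  | 0 => μ₀
  | k + 1 => cloudStep (γ k) (α k) (multiplierMechanism g γ α μ₀ wg u ω k)
      (constraintMechanism g wg u ω k)

end PrivOpt

end

open PrivOpt

namespace PrivOpt

/-! ### Densities of shifted Gaussian measures -/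

/-! Privacy. All times `0, …, k` are treated at once. After rescaling by the standard deviations,
the noise is one standard Gaussian vector on a Hilbert sum, and replacing the input by an adjacent
one shifts it by a vector `a`. The Lipschitz bound and the lower bound on the noise give `‖a‖ κ ≤
1`. The shifted law has density `exp(⟨a, z⟩ - ‖a‖²/2)`, and by the choice of `κ` it exceeds `exp ε`
only on a set of shifted mass at most `δ` (`stdGaussian_shift_le`). The multipliers are a causal
function of the released constraint values, so they inherit privacy by post-processing.

Convergence. The operator `(∇ₓL, -g)` is monotone on `X × ℝᵐ₊`, but in general not strongly so.
Adding `α` times the identity makes it strongly monotone. Its variational inequality has a solution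
`z(α)`, a saddle point of the regularized Lagrangian (`exists_isRegularizedSaddle`). The Slater
point keeps `z(α)` bounded as `α → 0`, so every limit point is a saddle point of `L`; this gives
existence, and with uniqueness `z(α) → (xhat, μhat)`. Moreover `z` moves slowly: `‖z(α') - z(α)‖ ≤
√2 R |α - α'| / α`, which is `O(1/k)` along a power sequence.

Let `e(k)` be the mean-square distance of the iterate to `z(α(k))`. The noise at time `k` is
independent of the iterate at time `k`, so the terms linear in it have mean zero. The noise
multiplied by `μ(k)` has second moment `O(1 + E‖μ(k)‖²)`, which is absorbed into `e(k)`. With `ρ =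
γα` this yields `e(k+1) ≤ (1 + ρ)((1 - 2ρ + Cγ²) e(k) + Cγ²) + (1 + 1/ρ) D/k²`. Here `γ² = o(ρ)`
because `c₂ < c₁`, while `1/k² = o(ρ²)` and `∑ ρ = ∞` because `c₁ + c₂ < 1`; hence `e → 0`
(`tendsto_zero_of_powerSeq_recursion`).

Uniqueness. The primal part of any saddle point is a constrained minimizer. At an interior regular
point, stationarity and complementary slackness determine the multiplier. -/

theorem pi_withDensity_eq {ι : Type*} [Fintype ι] {E : ι → Type*} [∀ i, MeasurableSpace (E i)]
    (ν : ∀ i, Measure (E i)) [∀ i, IsProbabilityMeasure (ν i)] (ρ : ∀ i, E i → ℝ≥0∞)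
    (hρ : ∀ i, Measurable (ρ i)) [∀ i, SigmaFinite ((ν i).withDensity (ρ i))] :
    Measure.pi (fun i => (ν i).withDensity (ρ i)) =
      (Measure.pi ν).withDensity fun x => ∏ i, ρ i (x i) := by
  refine Measure.pi_eq fun s hs => ?_
  rw [withDensity_apply _ (MeasurableSet.univ_pi hs),
    ← lintegral_indicator (MeasurableSet.univ_pi hs)]
  have h : ((Set.univ.pi s).indicator fun x : (∀ i, E i) => ∏ i, ρ i (x i)) =
      fun x => ∏ i, (s i).indicator (ρ i) (x i) := by
    ext x
    by_cases hx : x ∈ Set.univ.pi s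
    · rw [Set.indicator_of_mem hx]
      exact Finset.prod_congr rfl fun i _ => by rw [Set.indicator_of_mem (hx i (Set.mem_univ i))]
    · rw [Set.indicator_of_notMem hx]
      simp only [Set.mem_pi, Set.mem_univ, true_imp_iff, not_forall] at hx
      obtain ⟨i, hi⟩ := hx
      exact (Finset.prod_eq_zero (Finset.mem_univ i) (Set.indicator_of_notMem hi _)).symm
  have hm : ∀ i, Measurable ((s i).indicator (ρ i)) := fun i => (hρ i).indicator (hs i)
  rw [h, lintegral_prod_eq_prod_lintegral_of_indepFun Finset.univ
    (fun i (x : ∀ i, E i) => (s i).indicator (ρ i) (x i))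
    (iIndepFun_pi fun i => (hm i).aemeasurable) fun i => (hm i).comp (measurable_pi_apply i)]
  refine Finset.prod_congr rfl fun i _ => ?_
  rw [(measurePreserving_eval ν i).lintegral_comp (hm i), lintegral_indicator (hs i),
    withDensity_apply _ (hs i)]

theorem gaussianReal_map_add_eq_withDensity (a : ℝ) :
    (gaussianReal 0 1).map (· + a) =
      (gaussianReal 0 1).withDensity fun z => ENNReal.ofReal (Real.exp (a * z - a ^ 2 / 2)) := by
  rw [gaussianReal_map_add_const, gaussianReal_of_var_ne_zero _ one_ne_zero,
    gaussianReal_of_var_ne_zero _ one_ne_zero,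
    ← withDensity_mul _ (measurable_gaussianPDF _ _) (by fun_prop)]
  congr 1
  ext z
  simp only [Pi.mul_apply, gaussianPDF, gaussianPDFReal]
  rw [← ENNReal.ofReal_mul (by positivity), mul_assoc _ (Real.exp _) (Real.exp _), ← Real.exp_add]
  congr 3
  simp only [NNReal.coe_one]
  ring_nf

theorem pi_gaussianReal_map_add {ι : Type*} [Fintype ι] (a : ι → ℝ) :
    (Measure.pi fun _ : ι => gaussianReal 0 1).map (· + a) =
      (Measure.pi fun _ : ι => gaussianReal 0 1).withDensity fun z =>
        ENNReal.ofReal (Real.exp (∑ i, a i * z i - (∑ i, a i ^ 2) / 2)) := by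
  have h1 : ∀ i, IsProbabilityMeasure ((gaussianReal 0 1).map (· + a i)) := fun i =>
    Measure.isProbabilityMeasure_map (by fun_prop)
  have h2 := Measure.pi_map_pi (μ := fun _ : ι => gaussianReal 0 1) (f := fun i z => z + a i)
    fun i => by fun_prop
  have h3 : ∀ i, SigmaFinite ((gaussianReal 0 1).withDensity fun z =>
      ENNReal.ofReal (Real.exp (a i * z - a i ^ 2 / 2))) := fun i => by
    rw [← gaussianReal_map_add_eq_withDensity]; infer_instance
  simp_rw [gaussianReal_map_add_eq_withDensity] at h2
  rw [pi_withDensity_eq _ _ fun i => by fun_prop] at h2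
  refine Eq.trans h2 ?_
  congr 1
  ext z
  rw [← ENNReal.ofReal_prod_of_nonneg fun i _ => (Real.exp_pos _).le, ← Real.exp_sum,
    Finset.sum_sub_distrib, Finset.sum_div]

section Shift

variable {E : Type*} [NormedAddCommGroup E] [InnerProductSpace ℝ E] [FiniteDimensional ℝ E]
  [MeasurableSpace E] [BorelSpace E]

/-- Coordinates in an orthonormal basis reduce this to the product of one-dimensional Gaussians. -/
theorem stdGaussian_map_add (a : E) :
    (stdGaussian E).map (· + a) = (stdGaussian E).withDensity fun z =>
      ENNReal.ofReal (Real.exp (inner ℝ a z - ‖a‖ ^ 2 / 2)) := by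
  set e := stdOrthonormalBasis ℝ E
  set Φ : (Fin (Module.finrank ℝ E) → ℝ) → E := fun x => ∑ i, x i • e i with hΦ
  have hΦm : Measurable Φ := by fun_prop
  have ha : Φ (fun i => inner ℝ (e i) a) = a := e.sum_repr' a
  have hadd : (fun z => z + a) ∘ Φ = Φ ∘ fun x => x + fun i => inner ℝ (e i) a := by
    ext1 x
    conv_lhs => rw [← ha]
    simp [hΦ, add_smul, Finset.sum_add_distrib]
  have hstd : stdGaussian E = (Measure.pi fun _ => gaussianReal 0 1).map Φ := rfl
  have hmeas : Measurable fun z : E =>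
      ENNReal.ofReal (Real.exp (inner ℝ a z - ‖a‖ ^ 2 / 2)) := by fun_prop
  rw [hstd, Measure.map_map (by fun_prop) hΦm, hadd, ← Measure.map_map hΦm (by fun_prop),
    pi_gaussianReal_map_add]
  refine Measure.ext fun s hs => ?_
  rw [Measure.map_apply hΦm hs, withDensity_apply _ (hΦm hs), withDensity_apply _ hs,
    setLIntegral_map hs hmeas hΦm]
  refine lintegral_congr fun x => ?_
  have h1 : inner ℝ a (Φ x) = ∑ i, inner ℝ (e i) a * x i := by
    simp only [hΦ, inner_sum, inner_smul_right, real_inner_comm, mul_comm]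
  have h2 : ∑ i, inner ℝ (e i) a ^ 2 = ‖a‖ ^ 2 := e.sum_sq_inner_right a
  rw [h1, h2]

theorem stdGaussian_map_inner (a : E) :
    (stdGaussian E).map (fun z => inner ℝ a z) = gaussianReal 0 (‖a‖₊ ^ 2) := by
  have h := IsGaussian.map_eq_gaussianReal (μ := stdGaussian E) (innerSL ℝ a)
  rw [integral_strongDual_stdGaussian, variance_dual_stdGaussian, innerSL_apply_norm] at h
  convert h using 2
  · ext; simp
  rw [Real.toNNReal_pow (norm_nonneg a), norm_toNNReal]

end Shift

/-! ### The Gaussian tail -/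

theorem gaussianReal_Ioi_eq_gaussianTail (t : ℝ) :
    gaussianReal 0 1 (Set.Ioi t) = ENNReal.ofReal (gaussianTail t) := by
  rw [gaussianReal_apply_eq_integral _ one_ne_zero, gaussianTail, ← integral_const_mul]
  congr 2
  ext u
  simp [gaussianPDFReal]

theorem gaussianTail_eq_measureReal (t : ℝ) :
    gaussianTail t = (gaussianReal 0 1).real (Set.Ioi t) := by
  rw [measureReal_def, gaussianReal_Ioi_eq_gaussianTail, ENNReal.toReal_ofReal]
  unfold gaussianTail
  have : 0 ≤ ∫ u in Set.Ioi t, Real.exp (-u ^ 2 / 2) := integral_nonneg fun u => (Real.exp_pos _).le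
  positivity

theorem gaussianTail_antitone : Antitone gaussianTail := fun s t hst => by
  rw [gaussianTail_eq_measureReal, gaussianTail_eq_measureReal]
  exact measureReal_mono (Set.Ioi_subset_Ioi hst)

theorem gaussianTail_eq_one_sub_cdf (t : ℝ) : gaussianTail t = 1 - cdf (gaussianReal 0 1) t := by
  rw [gaussianTail_eq_measureReal, cdf_eq_real, ← Set.compl_Iic,
    probReal_compl_eq_one_sub measurableSet_Iic]

theorem continuous_gaussianTail : Continuous gaussianTail := by
  have hint : Integrable fun u : ℝ => Real.exp (-u ^ 2 / 2) := by
    have := integrable_exp_neg_mul_sq (b := 1 / 2) (by norm_num)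
    refine this.congr (ae_of_all _ fun u => ?_)
    ring_nf
  have h : gaussianTail = fun t => 1 / √(2 * Real.pi) *
      ((∫ u in Set.Ioi 0, Real.exp (-u ^ 2 / 2)) - ∫ u in (0 : ℝ)..t, Real.exp (-u ^ 2 / 2)) := by
    ext t
    rw [gaussianTail, ← intervalIntegral.integral_interval_add_Ioi
      (hint.integrableOn (s := Set.Ioi 0)) (hint.integrableOn (s := Set.Ioi t)), add_sub_cancel_left]
  rw [h]
  exact continuous_const.mul (continuous_const.sub
    (intervalIntegral.continuous_primitive (fun a b => hint.intervalIntegrable) 0))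

/-- By continuity and the limits `1` and `0` at the two ends, `δ` is attained. A preimage is all
that is needed, so injectivity of the tail plays no role. -/
theorem gaussianTail_invFun {δ : ℝ} (h0 : 0 < δ) (h1 : δ < 1) :
    gaussianTail (Function.invFun gaussianTail δ) = δ := by
  refine Function.invFun_eq ?_
  have hb : Tendsto gaussianTail atBot (𝓝 1) := by
    simp_rw [funext gaussianTail_eq_one_sub_cdf]
    simpa using (tendsto_cdf_atBot (gaussianReal 0 1)).const_sub 1
  have ht : Tendsto gaussianTail atTop (𝓝 0) := by
    simp_rw [funext gaussianTail_eq_one_sub_cdf]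
    simpa using (tendsto_cdf_atTop (gaussianReal 0 1)).const_sub 1
  obtain ⟨s, hs⟩ := (hb.eventually (lt_mem_nhds h1)).exists
  obtain ⟨t, ht⟩ := (ht.eventually (gt_mem_nhds h0)).exists
  exact mem_range_of_exists_le_of_exists_ge continuous_gaussianTail ⟨t, ht.le⟩ ⟨s, hs.le⟩

theorem kappa_pos {δ ε : ℝ} (hε : 0 < ε) : 0 < kappa δ ε := by
  unfold kappa
  set K := Function.invFun gaussianTail δ
  have : -K < √(K ^ 2 + 2 * ε) := by
    refine lt_of_le_of_lt (neg_le_abs K) ?_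
    rw [← Real.sqrt_sq_eq_abs]
    exact Real.sqrt_lt_sqrt (sq_nonneg K) (by linarith)
  have h2 : 0 < K + √(K ^ 2 + 2 * ε) := by linarith
  positivity

theorem kappa_quadratic {δ ε : ℝ} (hε : 0 < ε) :
    ε * kappa δ ε ^ 2 - Function.invFun gaussianTail δ * kappa δ ε - 1 / 2 = 0 := by
  unfold kappa
  set K := Function.invFun gaussianTail δ
  have h := Real.sq_sqrt (show 0 ≤ K ^ 2 + 2 * ε by positivity)
  field_simp
  rw [mul_comm ε 2]
  linear_combination h

/-- Since `κ` is the positive root of `εκ² - Kκ - 1/2`, one has `K = εκ - 1/(2κ)`. This is the value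
of the decreasing function `d ↦ ε/d - d/2` at `d = 1/κ`. -/
theorem invFun_gaussianTail_le {δ ε d : ℝ} (hε : 0 < ε) (hd : 0 < d) (hdκ : d * kappa δ ε ≤ 1) :
    Function.invFun gaussianTail δ ≤ (ε - d ^ 2 / 2) / d := by
  have hκ := kappa_pos (δ := δ) hε
  have hq := kappa_quadratic (δ := δ) hε
  set K := Function.invFun gaussianTail δ
  set κ := kappa δ ε
  rw [le_div_iff₀ hd]
  have hK : K = ε * κ - 1 / (2 * κ) := by
    field_simp
    linarith
  have h1 : d * ε * κ ≤ ε := by nlinarith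
  have h2 : d ^ 2 ≤ d / κ := by
    rw [le_div_iff₀ hκ]; nlinarith
  have h3 : K * d = d * ε * κ - (d / κ) / 2 := by
    rw [hK]; field_simp
  linarith

theorem gaussianReal_sq_Ioi_le {δ ε : ℝ} (hε : 0 < ε) (h0 : 0 < δ) (h1 : δ < 1) (d : ℝ≥0)
    (hdκ : d * kappa δ ε ≤ 1) :
    gaussianReal 0 (d ^ 2) (Set.Ioi (ε - (d : ℝ) ^ 2 / 2)) ≤ ENNReal.ofReal δ := by
  -- For `d = 0` the Gaussian degenerates to a point mass at `0`, which lies outside `(ε, ∞)`.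
  rcases eq_or_lt_of_le (zero_le : 0 ≤ d) with rfl | hd
  · have : (0 : ℝ) ∉ Set.Ioi ε := by simp [hε.le]
    simp [gaussianReal_zero_var, this]
  · have hd' : (0 : ℝ) < d := hd
    have hmap : (gaussianReal 0 1).map (fun z => (d : ℝ) * z) = gaussianReal 0 (d ^ 2) := by
      rw [gaussianReal_map_const_mul]
      congr 1
      · simp
      · ext; simp
    rw [← hmap, Measure.map_apply (by fun_prop) measurableSet_Ioi]
    have hpre : (fun z => (d : ℝ) * z) ⁻¹' Set.Ioi (ε - (d : ℝ) ^ 2 / 2) =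
        Set.Ioi ((ε - (d : ℝ) ^ 2 / 2) / d) := by
      ext z
      simp [div_lt_iff₀ hd', mul_comm]
    rw [hpre, gaussianReal_Ioi_eq_gaussianTail]
    refine ENNReal.ofReal_le_ofReal ?_
    rw [← gaussianTail_invFun h0 h1]
    refine (gaussianTail_antitone (invFun_gaussianTail_le hε hd' hdκ)).trans_eq ?_
    rw [gaussianTail_invFun h0 h1]

/-! ### The Gaussian mechanism -/

/-- Let `D` be the set where the logarithm of the shifted density exceeds `ε`. Off `D` the density
is at most `exp ε`. The shift pulls `D` back to the half-space `⟨a, z⟩ > ε - ‖a‖²/2`, and `⟨a, z⟩`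
is `N(0, ‖a‖²)`, so `D` has shifted mass at most `δ`. -/
theorem stdGaussian_shift_le {E : Type*} [NormedAddCommGroup E] [InnerProductSpace ℝ E]
    [FiniteDimensional ℝ E] [MeasurableSpace E] [BorelSpace E] {δ ε : ℝ} (hε : 0 < ε)
    (h0 : 0 < δ) (h1 : δ < 1) (a : E) (ha : ‖a‖ * kappa δ ε ≤ 1) {A : Set E}
    (hA : MeasurableSet A) :
    (stdGaussian E).map (· + a) A ≤
      ENNReal.ofReal (Real.exp ε) * stdGaussian E A + ENNReal.ofReal δ := by
  set D : Set E := {z | ε < inner ℝ a z - ‖a‖ ^ 2 / 2} with hD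
  have hDm : MeasurableSet D := measurableSet_lt (by fun_prop) (by fun_prop)
  have hsplit : (stdGaussian E).map (· + a) A ≤
      (stdGaussian E).map (· + a) (A ∩ Dᶜ) + (stdGaussian E).map (· + a) D := by
    refine (measure_mono fun z hz => ?_).trans (measure_union_le _ _)
    by_cases hzD : z ∈ D
    · exact Or.inr hzD
    · exact Or.inl ⟨hz, hzD⟩
  refine hsplit.trans (add_le_add ?_ ?_)
  · rw [stdGaussian_map_add, withDensity_apply _ (hA.inter hDm.compl)]
    calc ∫⁻ z in A ∩ Dᶜ, ENNReal.ofReal (Real.exp (inner ℝ a z - ‖a‖ ^ 2 / 2)) ∂stdGaussian E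
        ≤ ∫⁻ _ in A ∩ Dᶜ, ENNReal.ofReal (Real.exp ε) ∂stdGaussian E := by
          refine setLIntegral_mono measurable_const fun z hz => ?_
          have : inner ℝ a z - ‖a‖ ^ 2 / 2 ≤ ε := not_lt.1 hz.2
          gcongr
      _ = ENNReal.ofReal (Real.exp ε) * stdGaussian E (A ∩ Dᶜ) := setLIntegral_const _ _
      _ ≤ _ := by gcongr; exact Set.inter_subset_left
  · rw [Measure.map_apply (by fun_prop) hDm]
    have hpre : (fun z => z + a) ⁻¹' D =
        (fun z => inner ℝ a z) ⁻¹' Set.Ioi (ε - ‖a‖ ^ 2 / 2) := by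
      ext z
      simp only [hD, Set.mem_preimage, Set.mem_ofPred_eq, Set.mem_Ioi, inner_add_right,
        real_inner_self_eq_norm_sq]
      constructor <;> intro h <;> linarith
    rw [hpre, ← Measure.map_apply (by fun_prop) measurableSet_Ioi, stdGaussian_map_inner]
    exact gaussianReal_sq_Ioi_le hε h0 h1 ‖a‖₊ ha

theorem map_toLp_pi_stdGaussian {ι : Type*} [Fintype ι] (m : ℕ) :
    (Measure.pi fun _ : ι => stdGaussian (Vec m)).map (WithLp.toLp 2) =
      stdGaussian (PiLp 2 fun _ : ι => Vec m) := by
  apply Measure.ext_of_charFun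
  ext t
  simp_rw [charFun_stdGaussian, charFun_pi, charFun_stdGaussian, ← Complex.exp_sum,
    ← Complex.ofReal_pow, PiLp.norm_sq_eq_of_L2]
  simp [Finset.sum_div, neg_div]

theorem multivariateGaussian_zero_sq_smul_one {m : ℕ} (s : ℝ) :
    multivariateGaussian (0 : Vec m) (s ^ 2 • 1) = (stdGaussian (Vec m)).map (s • ·) := by
  apply Measure.ext_of_charFun
  ext t
  have hps : (s ^ 2 • (1 : Matrix (Fin m) (Fin m) ℝ)).PosSemidef :=
    Matrix.PosSemidef.one.smul (sq_nonneg s)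
  have hdot : t.ofLp ⬝ᵥ (s ^ 2 • (1 : Matrix (Fin m) (Fin m) ℝ)).mulVec t.ofLp =
      (‖s‖ * ‖t‖) ^ 2 := by
    rw [mul_pow, EuclideanSpace.real_norm_sq_eq, Matrix.smul_mulVec, Matrix.one_mulVec,
      dotProduct_smul, smul_eq_mul, Real.norm_eq_abs, sq_abs]
    simp [dotProduct, ← pow_two]
  rw [charFun_multivariateGaussian hps, charFun_map_smul, charFun_stdGaussian, norm_smul, hdot]
  simp [neg_div]

/-- The vectors `a t` measure the change of the output in units of the noise. The form `u = v + σ •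
a`, rather than a quotient by `σ`, also covers times at which `σ` vanishes. -/
theorem gaussian_mechanism {m : ℕ} {Ω : Type*} [MeasurableSpace Ω] {P : Measure Ω}
    [IsProbabilityMeasure P] {W : ℕ → Ω → Vec m} {σ : ℕ → ℝ}
    (hW : ∀ t, HasLaw (W t) (multivariateGaussian 0 (σ t ^ 2 • 1)) P) (hind : iIndepFun W P)
    {δ ε : ℝ} (hε : 0 < ε) (h0 : 0 < δ) (h1 : δ < 1) (u v a : ℕ → Vec m)
    (huv : ∀ t, u t = v t + σ t • a t) (k : ℕ)
    (ha : √(∑ t : Fin (k + 1), ‖a t‖ ^ 2) * kappa δ ε ≤ 1)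
    {S : Set (Fin (k + 1) → Vec m)} (hS : MeasurableSet S) :
    P {ω | (fun t : Fin (k + 1) => u t + W t ω) ∈ S} ≤
      ENNReal.ofReal (Real.exp ε) * P {ω | (fun t : Fin (k + 1) => v t + W t ω) ∈ S} +
        ENNReal.ofReal δ := by
  set γ := stdGaussian (PiLp 2 fun _ : Fin (k + 1) => Vec m) with hγ
  have hWm : ∀ t : Fin (k + 1), AEMeasurable (W t) P := fun t => (hW t).aemeasurable
  have hlaw : P.map (fun ω (t : Fin (k + 1)) => W t ω) =
      γ.map fun z (t : Fin (k + 1)) => σ t • z t := by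
    have hi : iIndepFun (fun (t : Fin (k + 1)) => W t) P :=
      hind.precomp (g := fun t : Fin (k + 1) => (t : ℕ)) Fin.val_injective
    rw [(iIndepFun_iff_map_fun_eq_pi_map hWm).1 hi]
    simp_rw [(hW _).map_eq, multivariateGaussian_zero_sq_smul_one]
    have : ∀ t : Fin (k + 1), IsProbabilityMeasure ((stdGaussian (Vec m)).map (σ t • ·)) :=
      fun t => Measure.isProbabilityMeasure_map (by fun_prop)
    rw [← Measure.pi_map_pi fun t => by fun_prop, hγ, ← map_toLp_pi_stdGaussian,
      Measure.map_map (by fun_prop) (by fun_prop)]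
    rfl
  have hprob : ∀ c : ℕ → Vec m, P {ω | (fun t : Fin (k + 1) => c t + W t ω) ∈ S} =
      γ {z | (fun t : Fin (k + 1) => c t + σ t • z t) ∈ S} := fun c => by
    have hc : Measurable fun (y : Fin (k + 1) → Vec m) (t : Fin (k + 1)) => c t + y t := by
      fun_prop
    have hP := Measure.map_apply_of_aemeasurable (aemeasurable_pi_lambda _ hWm) (hc hS)
    rw [hlaw, Measure.map_apply (by fun_prop) (hc hS)] at hP
    exact hP.symm
  rw [hprob, hprob]
  set A : Set (PiLp 2 fun _ : Fin (k + 1) => Vec m) := {z | (fun t : Fin (k + 1) => v t + σ t • z t) ∈ S}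
  have hAm : Measurable fun (z : PiLp 2 fun _ : Fin (k + 1) => Vec m) (t : Fin (k + 1)) => v t + σ t • z t := by fun_prop
  have hA : MeasurableSet A := hAm hS
  set aE : PiLp 2 fun _ : Fin (k + 1) => Vec m := WithLp.toLp 2 fun t : Fin (k + 1) => a t
  have hset : {z : PiLp 2 fun _ : Fin (k + 1) => Vec m | (fun t : Fin (k + 1) => u t + σ t • z t) ∈ S} = (· + aE) ⁻¹' A := by
    ext z
    refine iff_of_eq (congrArg (· ∈ S) (funext fun t => ?_))
    rw [huv, PiLp.add_apply, smul_add]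
    abel
  have hnorm : ‖aE‖ = √(∑ t : Fin (k + 1), ‖a t‖ ^ 2) := PiLp.norm_eq_of_L2 _
  rw [hset, ← Measure.map_apply (by fun_prop) hA]
  exact stdGaussian_shift_le hε h0 h1 aE (hnorm ▸ ha) hA

theorem Adjacent.norm_sub_eq {n : ℕ} {u v : ℕ → Vec n} {i : Fin n}
    (h : ∀ j, j ≠ i → ∀ k, u k j = v k j) (k : ℕ) : ‖u k - v k‖ = |u k i - v k i| := by
  rw [EuclideanSpace.norm_eq, Finset.sum_eq_single i, PiLp.sub_apply, Real.norm_eq_abs, sq_abs,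
    Real.sqrt_sq_eq_abs]
  · intro j _ hj
    simp [h j hj k]
  · simp

theorem isDiffPrivate_of_lipschitz {n m : ℕ} [NeZero n] {X : Set (Vec n)} {G : Vec n → Vec m}
    {K : ℝ≥0} (hG : LipschitzOnWith K G X) {ε δ : ℝ} (hε : 0 < ε) (h0 : 0 < δ) (h1 : δ < 1)
    {b : Fin n → ℝ} (hb : ∀ i, 0 ≤ b i) {B : ℝ}
    (hB : B = Finset.univ.sup' Finset.univ_nonempty b) {σ : ℕ → ℝ}
    (hσ : ∀ k, kappa δ ε * K * B ≤ σ k) {Ω : Type*} [MeasurableSpace Ω] {P : Measure Ω}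
    [IsProbabilityMeasure P] {W : ℕ → Ω → Vec m}
    (hW : ∀ t, HasLaw (W t) (multivariateGaussian 0 (σ t ^ 2 • 1)) P) (hind : iIndepFun W P) :
    IsDiffPrivate P X b ε δ fun u ω k => G (u k) + W k ω := by
  rintro u v hu hv ⟨i, hsum, hle, hne⟩ k S hS
  have hκ : 0 < kappa δ ε := kappa_pos hε
  have hbB : b i ≤ B := hB ▸ Finset.le_sup' b (Finset.mem_univ i)
  have hB0 : 0 ≤ B := (hb i).trans hbB
  have hsq : ∑' t, (u t i - v t i) ^ 2 ≤ B ^ 2 :=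
    (Real.sqrt_le_left (hB0)).1 (hle.trans hbB)
  have hdist : ∀ t, ‖G (u t) - G (v t)‖ ≤ K * |u t i - v t i| := fun t => by
    rw [← Adjacent.norm_sub_eq hne, ← dist_eq_norm, ← dist_eq_norm]
    exact hG.dist_le_mul _ (hu t) _ (hv t)
  have hterm : ∀ t, (u t i - v t i) ^ 2 ≤ B ^ 2 := fun t =>
    (hsum.le_tsum t fun _ _ => sq_nonneg _).trans hsq
  -- Without noise at time `t` the lower bound forces `K * B ≤ 0`, so the two outputs agree. The
  -- convention `0⁻¹ = 0` is then harmless in `a`.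
  have hzero : ∀ t, σ t = 0 → G (u t) = G (v t) := fun t ht => by
    have hKB : kappa δ ε * K * B ≤ 0 := ht ▸ hσ t
    have h2 : (K : ℝ) * B ≤ 0 := by
      rw [mul_assoc] at hKB
      exact nonpos_of_mul_nonpos_right hKB hκ
    have h3 : |u t i - v t i| ≤ B := abs_le_of_sq_le_sq (hterm t) hB0
    have h4 : (K : ℝ) * |u t i - v t i| ≤ K * B := by gcongr
    exact sub_eq_zero.1 (norm_le_zero_iff.1 ((hdist t).trans (h4.trans h2)))
  set a : ℕ → Vec m := fun t => (σ t)⁻¹ • (G (u t) - G (v t)) with ha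
  refine gaussian_mechanism hW hind hε h0 h1 (fun t => G (u t)) (fun t => G (v t)) a (fun t => ?_)
    k ?_ hS
  · rcases eq_or_ne (σ t) 0 with h | h
    · simp [h, hzero t h]
    · simp [ha, smul_smul, mul_inv_cancel₀ h]
  · have hat : ∀ t, (‖a t‖ * kappa δ ε * B) ^ 2 ≤ (u t i - v t i) ^ 2 := fun t => by
      rw [← sq_abs (u t i - v t i)]
      have hσ0 : 0 ≤ σ t := le_trans (by positivity) (hσ t)
      refine pow_le_pow_left₀ (by positivity) ?_ 2
      rcases hσ0.eq_or_lt with h | h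
      · simp [ha, ← h]
      · rw [ha, norm_smul, norm_inv, Real.norm_of_nonneg hσ0, mul_assoc, inv_mul_eq_div,
          div_mul_eq_mul_div, div_le_iff₀ h]
        calc ‖G (u t) - G (v t)‖ * (kappa δ ε * B)
            ≤ (K * |u t i - v t i|) * (kappa δ ε * B) := by gcongr; exact hdist t
          _ = |u t i - v t i| * (kappa δ ε * K * B) := by ring
          _ ≤ |u t i - v t i| * σ t := by gcongr; exact hσ t
    -- The bound on `‖a‖` is obtained by cancelling `B ^ 2`, so `B = 0`, where the two signals
    -- coincide, is treated separately.
    rcases hB0.eq_or_lt with h | h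
    · have : ∀ t, a t = 0 := fun t => by
        have h5 : |u t i - v t i| ≤ 0 := by
          have := hterm t
          rw [← h] at this
          exact (abs_nonpos_iff.2 (pow_eq_zero_iff two_ne_zero |>.1 (by nlinarith)))
        have h6 := hdist t
        rw [le_antisymm h5 (abs_nonneg _), mul_zero, norm_le_zero_iff] at h6
        simp [ha, h6]
      simp [this]
    · have hsum' : (∑ t : Fin (k + 1), ‖a t‖ ^ 2) * (kappa δ ε * B) ^ 2 ≤ B ^ 2 := by
        refine le_trans ?_ hsq
        rw [Finset.sum_mul]
        calc ∑ t : Fin (k + 1), ‖a t‖ ^ 2 * (kappa δ ε * B) ^ 2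
            ≤ ∑ t : Fin (k + 1), (u t i - v t i) ^ 2 :=
              Finset.sum_le_sum fun t _ => by rw [← mul_pow, ← mul_assoc]; exact hat t
          _ = ∑ t ∈ Finset.range (k + 1), (u t i - v t i) ^ 2 :=
              Fin.sum_univ_eq_sum_range (fun t => (u t i - v t i) ^ 2) _
          _ ≤ _ := hsum.sum_le_tsum _ fun _ _ => sq_nonneg _
      have h7 : (∑ t : Fin (k + 1), ‖a t‖ ^ 2) * kappa δ ε ^ 2 ≤ 1 := by
        rw [mul_pow, ← mul_assoc] at hsum'
        exact le_of_mul_le_mul_right (by simpa using hsum') (by positivity : 0 < B ^ 2)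
      rw [← Real.sqrt_sq hκ.le, ← Real.sqrt_mul' _ (sq_nonneg _)]
      exact Real.sqrt_le_one.2 h7

/-! ### Post-processing and the multipliers -/

theorem IsDiffPrivate.postprocess {n : ℕ} {Ω F F' : Type*} [MeasurableSpace Ω]
    [MeasurableSpace F] [MeasurableSpace F'] {P : Measure Ω} {X : Set (Vec n)} {b : Fin n → ℝ}
    {ε δ : ℝ} {M : (ℕ → Vec n) → Ω → ℕ → F} (hM : IsDiffPrivate P X b ε δ M)
    {M' : (ℕ → Vec n) → Ω → ℕ → F'}
    (h : ∀ k, ∃ Φ : (Fin (k + 1) → F) → Fin (k + 1) → F', Measurable Φ ∧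
      ∀ u ω, (fun t : Fin (k + 1) => M' u ω t) = Φ fun t : Fin (k + 1) => M u ω t) :
    IsDiffPrivate P X b ε δ M' := by
  intro u v hu hv huv k S hS
  obtain ⟨Φ, hΦ, heq⟩ := h k
  simp_rw [heq]
  exact hM u v hu hv huv k _ (hΦ hS)

theorem continuous_cloudStep {m : ℕ} (γ α : ℝ) :
    Continuous fun p : Vec m × Vec m => cloudStep γ α p.1 p.2 := by
  unfold cloudStep
  fun_prop

/-- The multipliers as a function of the released constraint values. -/
def multiplierOf {m : ℕ} (γ α : ℕ → ℝ) (μ₀ : Vec m) (y : ℕ → Vec m) : ℕ → Vec m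
  | 0 => μ₀
  | k + 1 => cloudStep (γ k) (α k) (multiplierOf γ α μ₀ y k) (y k)

theorem multiplierMechanism_eq {n m : ℕ} {Ω : Type*} (g : Fin m → Vec n → ℝ) (γ α : ℕ → ℝ)
    (μ₀ : Vec m) (wg : ℕ → Ω → Vec m) (u : ℕ → Vec n) (ω : Ω) (k : ℕ) :
    multiplierMechanism g γ α μ₀ wg u ω k =
      multiplierOf γ α μ₀ (constraintMechanism g wg u ω) k := by
  induction k with
  | zero => rfl
  | succ k ih => rw [multiplierMechanism, multiplierOf, ih]

theorem multiplierOf_congr {m : ℕ} (γ α : ℕ → ℝ) (μ₀ : Vec m) {y y' : ℕ → Vec m} {k : ℕ}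
    (h : ∀ t < k, y t = y' t) : multiplierOf γ α μ₀ y k = multiplierOf γ α μ₀ y' k := by
  induction k with
  | zero => rfl
  | succ k ih =>
    rw [multiplierOf, multiplierOf, ih fun t ht => h t (ht.trans k.lt_succ_self),
      h k k.lt_succ_self]

theorem measurable_multiplierOf {m : ℕ} (γ α : ℕ → ℝ) (μ₀ : Vec m) (k : ℕ) :
    Measurable fun y : ℕ → Vec m => multiplierOf γ α μ₀ y k := by
  induction k with
  | zero => exact measurable_const
  | succ k ih =>
    exact (continuous_cloudStep (γ k) (α k)).measurable.comp (ih.prodMk (measurable_pi_apply k))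

theorem isDiffPrivate_multiplierMechanism {n m : ℕ} {Ω : Type*} [MeasurableSpace Ω]
    {P : Measure Ω} {X : Set (Vec n)} {b : Fin n → ℝ} {ε δ : ℝ} {g : Fin m → Vec n → ℝ}
    {wg : ℕ → Ω → Vec m} (h : IsDiffPrivate P X b ε δ (constraintMechanism g wg)) (γ α : ℕ → ℝ)
    (μ₀ : Vec m) : IsDiffPrivate P X b ε δ (multiplierMechanism g γ α μ₀ wg) := by
  -- The zeros beyond time `k` are never read: the multiplier at time `t` depends only on the
  -- constraint values before `t`.
  refine h.postprocess fun k => ⟨fun y t => multiplierOf γ α μ₀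
    (fun s => if hs : s < k + 1 then y ⟨s, hs⟩ else 0) t, ?_, fun u ω => ?_⟩
  · refine measurable_pi_lambda _ fun t => (measurable_multiplierOf γ α μ₀ t).comp ?_
    refine measurable_pi_lambda _ fun s => ?_
    by_cases hs : s < k + 1
    · simpa [hs] using measurable_pi_apply (⟨s, hs⟩ : Fin (k + 1))
    · simp [hs]
  · ext1 t
    rw [multiplierMechanism_eq]
    refine multiplierOf_congr γ α μ₀ fun s hs => ?_
    rw [dif_pos (hs.trans t.2)]

/-! ### The Euclidean projection -/

section Proj

variable {E : Type*} [NormedAddCommGroup E]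

theorem exists_isMinOn_norm_sub {X : Set E} (hX : IsCompact X) (hne : X.Nonempty) (y : E) :
    ∃ p ∈ X, ∀ q ∈ X, ‖y - p‖ ≤ ‖y - q‖ :=
  hX.exists_isMinOn hne (f := fun q => ‖y - q‖) (by fun_prop)

theorem proj_spec {X : Set E} {y : E} (h : ∃ p ∈ X, ∀ q ∈ X, ‖y - p‖ ≤ ‖y - q‖) :
    proj X y ∈ X ∧ ∀ q ∈ X, ‖y - proj X y‖ ≤ ‖y - q‖ := by
  rw [proj, dif_pos h]
  exact h.choose_spec

theorem proj_mem {X : Set E} (hX : IsCompact X) (hne : X.Nonempty) (y : E) : proj X y ∈ X := (proj_spec (exists_isMinOn_norm_sub hX hne y)).1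

theorem norm_sub_proj_le {X : Set E} (hX : IsCompact X) (hne : X.Nonempty) (y : E) :
    ∀ q ∈ X, ‖y - proj X y‖ ≤ ‖y - q‖ :=
  (proj_spec (exists_isMinOn_norm_sub hX hne y)).2

variable [InnerProductSpace ℝ E]

theorem inner_sub_le_zero_of_forall_norm_le {X : Set E} (hX : Convex ℝ X) {y p : E} (hp : p ∈ X)
    (h : ∀ q ∈ X, ‖y - p‖ ≤ ‖y - q‖) : ∀ q ∈ X, inner ℝ (y - p) (q - p) ≤ 0 := by
  refine (norm_eq_iInf_iff_real_inner_le_zero hX hp).1 (le_antisymm ?_ ?_)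
  · have : Nonempty X := ⟨⟨p, hp⟩⟩
    exact le_ciInf fun q => h q q.2
  · exact ciInf_le (f := fun q : X => ‖y - q‖) ⟨0, by rintro _ ⟨q, rfl⟩; exact norm_nonneg _⟩
      ⟨p, hp⟩

/-- Adding the obtuse-angle inequalities at the two nearest points gives `‖p - p'‖² ≤ ⟨y - y', p -
p'⟩`. No compactness enters, so the result also yields uniqueness of nearest points in the factors
of a product. -/
theorem norm_sub_le_of_forall_norm_le {X : Set E} (hX : Convex ℝ X) {y y' p p' : E} (hp : p ∈ X)
    (hp' : p' ∈ X) (h : ∀ q ∈ X, ‖y - p‖ ≤ ‖y - q‖) (h' : ∀ q ∈ X, ‖y' - p'‖ ≤ ‖y' - q‖) :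
    ‖p - p'‖ ≤ ‖y - y'‖ := by
  have h1 := inner_sub_le_zero_of_forall_norm_le hX hp h p' hp'
  have h2 := inner_sub_le_zero_of_forall_norm_le hX hp' h' p hp
  have h3 : ‖p - p'‖ * ‖p - p'‖ ≤ ‖y - y'‖ * ‖p - p'‖ := by
    refine le_trans ?_ (real_inner_le_norm (y - y') (p - p'))
    rw [← real_inner_self_eq_norm_mul_norm]
    have h4 : inner ℝ (y - y') (p - p') - inner ℝ (p - p') (p - p') =
        - inner ℝ (y - p) (p' - p) - inner ℝ (y' - p') (p - p') := by
      rw [← neg_sub p p', inner_neg_right, neg_neg, ← inner_sub_left, ← inner_sub_left]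
      congr 1
      abel
    linarith
  rcases (norm_nonneg (p - p')).eq_or_lt with h0 | h0
  · rw [← h0]; exact norm_nonneg _
  · exact le_of_mul_le_mul_right h3 h0

theorem norm_proj_sub_proj_le {X : Set E} (hX : IsCompact X) (hne : X.Nonempty)
    (hconv : Convex ℝ X) (y y' : E) :
    ‖proj X y - proj X y'‖ ≤ ‖y - y'‖ :=
  norm_sub_le_of_forall_norm_le hconv (proj_mem hX hne y) (proj_mem hX hne y')
    (norm_sub_proj_le hX hne y) (norm_sub_proj_le hX hne y')

theorem norm_proj_sub_le {X : Set E} (hX : IsCompact X) (hne : X.Nonempty)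
    (hconv : Convex ℝ X) (y : E) {q : E} (hq : q ∈ X) :
    ‖proj X y - q‖ ≤ ‖y - q‖ :=
  norm_sub_le_of_forall_norm_le hconv (proj_mem hX hne y) hq (norm_sub_proj_le hX hne y)
    fun q' _ => by simp

theorem continuous_proj {X : Set E} (hX : IsCompact X) (hne : X.Nonempty)
    (hconv : Convex ℝ X) : Continuous (proj X) :=
  (LipschitzWith.of_dist_le_mul (K := 1) fun y y' => by
    simpa [dist_eq_norm] using norm_proj_sub_proj_le hX hne hconv y y').continuous

end Proj

/-- Changing the `i`-th coordinate of the projection `p` to a point of `Y i` stays in `X`. Hence `p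
i` is nearest to `y i` in `Y i`, and `Y i` inherits convexity from `X`, which makes the nearest
point unique. -/
theorem proj_pi_apply {n : ℕ} {X : Set (Vec n)} (hX : IsCompact X) (hne : X.Nonempty)
    (hconv : Convex ℝ X) {Y : Fin n → Set ℝ} (hY : X = {z | ∀ i, z i ∈ Y i}) (y : Vec n)
    (i : Fin n) : proj X y i = proj (Y i) (y i) := by
  have hmem : ∀ z, z ∈ X ↔ ∀ i, z i ∈ Y i := fun z => by rw [hY]; rfl
  set p := proj X y with hp
  have hpX : p ∈ X := proj_mem hX hne y
  have hupd : ∀ q ∈ Y i, WithLp.toLp 2 (Function.update p.ofLp i q) ∈ X := fun q hq => by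
    rw [hmem]
    intro j
    rcases eq_or_ne j i with rfl | hj
    · simpa using hq
    · simpa [Function.update_of_ne hj] using (hmem p).1 hpX j
  have hmin : ∀ q ∈ Y i, ‖y i - p i‖ ≤ ‖y i - q‖ := fun q hq => by
    have h := norm_sub_proj_le hX hne y _ (hupd q hq)
    rw [← hp, ← pow_le_pow_iff_left₀ (norm_nonneg _) (norm_nonneg _) two_ne_zero,
      EuclideanSpace.norm_sq_eq, EuclideanSpace.norm_sq_eq,
      ← Finset.add_sum_erase _ _ (Finset.mem_univ i),
      ← Finset.add_sum_erase _ _ (Finset.mem_univ i)] at h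
    have hs : ∑ j ∈ Finset.univ.erase i,
        ‖(y - WithLp.toLp 2 (Function.update p.ofLp i q)) j‖ ^ 2 =
        ∑ j ∈ Finset.univ.erase i, ‖(y - p) j‖ ^ 2 := by
      refine Finset.sum_congr rfl fun j hj => ?_
      simp [Function.update_of_ne (Finset.ne_of_mem_erase hj)]
    rw [hs] at h
    rw [← pow_le_pow_iff_left₀ (norm_nonneg _) (norm_nonneg _) two_ne_zero]
    simp only [PiLp.sub_apply, Function.update_self] at h ⊢
    linarith
  have hYconv : Convex ℝ (Y i) := fun s hs t ht a c ha hc hac => by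
    have := (hmem _).1 (hconv (hupd s hs) (hupd t ht) ha hc hac) i
    simpa using this
  have hpi : p i ∈ Y i := (hmem p).1 hpX i
  obtain ⟨h1, h2⟩ := proj_spec (X := Y i) (y := y i) ⟨p i, hpi, hmin⟩
  have := norm_sub_le_of_forall_norm_le hYconv hpi h1 hmin h2
  simpa [sub_eq_zero] using this

/-! ### Regularized saddle points -/

theorem ConvexOn.fderiv_le_sub {E : Type*} [NormedAddCommGroup E] [NormedSpace ℝ E] {g : E → ℝ}
    (hg : ConvexOn ℝ Set.univ g) {x : E} (hd : DifferentiableAt ℝ g x) (y : E) :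
    fderiv ℝ g x (y - x) ≤ g y - g x := by
  have hφ : ConvexOn ℝ Set.univ (g ∘ AffineMap.lineMap (k := ℝ) x y) := by
    simpa using hg.comp_affineMap (AffineMap.lineMap (k := ℝ) x y)
  have hderiv : HasDerivAt (g ∘ AffineMap.lineMap (k := ℝ) x y) (fderiv ℝ g x (y - x)) 0 := by
    have h1 : HasFDerivAt g (fderiv ℝ g x) (AffineMap.lineMap (k := ℝ) x y (0 : ℝ)) := by
      simpa using hd.hasFDerivAt
    exact h1.comp_hasDerivAt (0 : ℝ) AffineMap.hasDerivAt_lineMap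
  have := hφ.le_slope_of_hasDerivAt (Set.mem_univ 0) (Set.mem_univ 1) one_pos hderiv
  simpa [slope_def_field] using this

theorem ConvexOn.deriv_mul_le_sub {f : ℝ → ℝ} (hf : ConvexOn ℝ Set.univ f) {s : ℝ}
    (hd : DifferentiableAt ℝ f s) (t : ℝ) : deriv f s * (t - s) ≤ f t - f s := by
  have := ConvexOn.fderiv_le_sub hf hd t
  rwa [fderiv_eq_smul_deriv, smul_eq_mul, mul_comm] at this

theorem hasDerivAt_max_zero_sq (s : ℝ) :
    HasDerivAt (fun t : ℝ => max t 0 ^ 2) (2 * max s 0) s := by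
  rw [hasDerivAt_iff_isLittleO]
  refine Asymptotics.IsBigO.trans_isLittleO (g := fun t => (t - s) ^ 2) ?_ ?_
  · refine Asymptotics.IsBigO.of_bound 1 (Eventually.of_forall fun t => ?_)
    rw [Real.norm_eq_abs, Real.norm_eq_abs, one_mul, abs_of_nonneg (sq_nonneg (t - s)), abs_le,
      smul_eq_mul]
    rcases le_total t 0 with ht | ht <;> rcases le_total s 0 with hs | hs <;>
      simp only [max_eq_left, max_eq_right, ht, hs] <;> constructor <;> nlinarith
  · have h1 : Tendsto (fun t : ℝ => t - s) (𝓝 s) (𝓝 0) := by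
      simpa using (continuous_sub_right s).tendsto s
    simpa [Function.comp_def] using (Asymptotics.isLittleO_pow_id (𝕜 := ℝ) one_lt_two).comp_tendsto h1

section Program

variable {n m : ℕ} {X : Set (Vec n)} {f : Fin n → ℝ → ℝ} {g : Fin m → Vec n → ℝ}

/-- The objective and the constraints are convex and twice continuously differentiable. -/
structure IsConvexProgram (f : Fin n → ℝ → ℝ) (g : Fin m → Vec n → ℝ) : Prop where
  convex_objective : ∀ i, ConvexOn ℝ Set.univ (f i)
  smooth_objective : ∀ i, ContDiff ℝ 2 (f i)
  convex_constraint : ∀ j, ConvexOn ℝ Set.univ (g j)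
  smooth_constraint : ∀ j, ContDiff ℝ 2 (g j)

namespace IsConvexProgram

theorem differentiable_objective (H : IsConvexProgram f g) (i : Fin n) : Differentiable ℝ (f i) :=
  (H.smooth_objective i).differentiable two_ne_zero

theorem differentiable_constraint (H : IsConvexProgram f g) (j : Fin m) :
    Differentiable ℝ (g j) :=
  (H.smooth_constraint j).differentiable two_ne_zero

theorem continuous_deriv_objective (H : IsConvexProgram f g) (i : Fin n) :
    Continuous (deriv (f i)) :=
  (H.smooth_objective i).continuous_deriv one_le_two

theorem continuous_constraintVec (H : IsConvexProgram f g) : Continuous (constraintVec g) := by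
  have := fun j => (H.smooth_constraint j).continuous
  unfold constraintVec
  fun_prop

theorem continuous_constraintPartial (H : IsConvexProgram f g) (i : Fin n) :
    Continuous (constraintPartial g i) := by
  have := fun j => (H.smooth_constraint j).continuous_fderiv two_ne_zero
  unfold constraintPartial
  fun_prop

end IsConvexProgram

/-- The gradient of the Lagrangian with respect to `x`. -/
noncomputable def primalGrad (f : Fin n → ℝ → ℝ) (g : Fin m → Vec n → ℝ) (x : Vec n) (μ : Vec m) : Vec n :=
  WithLp.toLp 2 fun i => deriv (f i) (x i) + inner ℝ (constraintPartial g i x) μ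

theorem continuous_primalGrad (H : IsConvexProgram f g) :
    Continuous fun p : Vec n × Vec m => primalGrad f g p.1 p.2 := by
  have h1 := H.continuous_deriv_objective
  have h2 := H.continuous_constraintPartial
  unfold primalGrad
  refine (PiLp.continuous_toLp 2 _).comp (continuous_pi fun i => ?_)
  exact ((h1 i).comp (by fun_prop)).add (((h2 i).comp continuous_fst).inner continuous_snd)

theorem fderiv_eq_sum_single {φ : Vec n →L[ℝ] ℝ} (h : Vec n) :
    φ h = ∑ i, h i * φ (EuclideanSpace.single i 1) := by
  conv_lhs => rw [← (EuclideanSpace.basisFun (Fin n) ℝ).sum_repr h]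
  simp

theorem inner_primalGrad (x : Vec n) (μ : Vec m) (h : Vec n) :
    inner ℝ (primalGrad f g x μ) h =
      ∑ i, deriv (f i) (x i) * h i + ∑ j, μ j * fderiv ℝ (g j) x h := by
  simp_rw [fderiv_eq_sum_single (φ := fderiv ℝ (g _) x) h, primalGrad, constraintPartial,
    PiLp.inner_apply, Finset.mul_sum]
  rw [Finset.sum_comm, ← Finset.sum_add_distrib]
  refine Finset.sum_congr rfl fun i _ => ?_
  simp only [RCLike.inner_apply, conj_trivial]
  rw [mul_add, mul_comm, Finset.mul_sum]
  congr 1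
  exact Finset.sum_congr rfl fun j _ => by ring

theorem inner_constraintVec (x : Vec n) (μ : Vec m) :
    inner ℝ (constraintVec g x) μ = ∑ j, μ j * g j x := by
  simp [constraintVec, PiLp.inner_apply]

theorem inner_primalGrad_le (H : IsConvexProgram f g) (x x' : Vec n) {μ : Vec m}
    (hμ : ∀ j, 0 ≤ μ j) :
    inner ℝ (primalGrad f g x μ) (x' - x) ≤ lagrangian f g x' μ - lagrangian f g x μ := by
  rw [inner_primalGrad, lagrangian, lagrangian, objective, objective, add_sub_add_comm,
    ← Finset.sum_sub_distrib, ← Finset.sum_sub_distrib]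
  refine add_le_add (Finset.sum_le_sum fun i _ => ?_) (Finset.sum_le_sum fun j _ => ?_)
  · exact ConvexOn.deriv_mul_le_sub (H.convex_objective i) (H.differentiable_objective i _) _
  · rw [← mul_sub]
    exact mul_le_mul_of_nonneg_left (ConvexOn.fderiv_le_sub (H.convex_constraint j)
      (H.differentiable_constraint j _) _) (hμ j)

theorem lagrangian_eq (x : Vec n) (μ : Vec m) :
    lagrangian f g x μ = objective f x + inner ℝ (constraintVec g x) μ := by
  rw [lagrangian, inner_constraintVec]

/-- The gradient inequalities of the convex functions `L(·, μ)` and `L(·, μ')` are added;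
nonnegativity of the multipliers is what makes these functions convex. -/
theorem lagrangian_monotone (H : IsConvexProgram f g) (x x' : Vec n) {μ μ' : Vec m}
    (hμ : ∀ j, 0 ≤ μ j) (hμ' : ∀ j, 0 ≤ μ' j) :
    0 ≤ inner ℝ (primalGrad f g x μ - primalGrad f g x' μ') (x - x') -
      inner ℝ (constraintVec g x - constraintVec g x') (μ - μ') := by
  have h1 := inner_primalGrad_le H x x' hμ
  have h2 := inner_primalGrad_le H x' x hμ'
  simp only [lagrangian_eq] at h1 h2
  simp only [inner_sub_left, inner_sub_right] at *
  linarith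

/-- A saddle point of `L(x, μ) + α/2 (‖x‖² - ‖μ‖²)` over `X × ℝᵐ₊`, as the solution of a variational
inequality. -/
structure IsRegularizedSaddle (X : Set (Vec n)) (f : Fin n → ℝ → ℝ) (g : Fin m → Vec n → ℝ)
    (α : ℝ) (y : Vec n) (ν : Vec m) : Prop where
  primal_mem : y ∈ X
  dual_nonneg : ∀ j, 0 ≤ ν j
  primal : ∀ x ∈ X, 0 ≤ inner ℝ (primalGrad f g y ν + α • y) (x - y)
  dual : ∀ μ : Vec m, (∀ j, 0 ≤ μ j) → 0 ≤ inner ℝ (α • ν - constraintVec g y) (μ - ν)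

theorem IsRegularizedSaddle.strongly_monotone (H : IsConvexProgram f g) {α : ℝ} {y : Vec n}
    {ν : Vec m} (h : IsRegularizedSaddle X f g α y ν) {x : Vec n} (hx : x ∈ X) {μ : Vec m}
    (hμ : ∀ j, 0 ≤ μ j) :
    α * (‖x - y‖ ^ 2 + ‖μ - ν‖ ^ 2) ≤ inner ℝ (primalGrad f g x μ + α • x) (x - y) +
      inner ℝ (α • μ - constraintVec g x) (μ - ν) := by
  have h1 := lagrangian_monotone H x y hμ h.dual_nonneg
  have h2 := h.primal x hx
  have h3 := h.dual μ hμ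
  rw [← real_inner_self_eq_norm_sq, ← real_inner_self_eq_norm_sq]
  simp only [inner_sub_left, inner_sub_right, inner_add_left, real_inner_smul_left] at *
  linarith

/-- Each variational inequality is tested at the other solution. The two operators differ by `α -
α'` times the identity, so strong monotonicity bounds `α` times the squared distance by `(α - α')`
times an inner product with `(y', ν')`. The factor `2` is from `(p + q)² ≤ 2(p² + q²)`. -/
theorem IsRegularizedSaddle.norm_sub_sq_le (H : IsConvexProgram f g) {α α' : ℝ} {y y' : Vec n}
    {ν ν' : Vec m} (hα : 0 < α) (h : IsRegularizedSaddle X f g α y ν)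
    (h' : IsRegularizedSaddle X f g α' y' ν') {R : ℝ} (hy' : ‖y'‖ ≤ R) (hν' : ‖ν'‖ ≤ R) :
    ‖y' - y‖ ^ 2 + ‖ν' - ν‖ ^ 2 ≤ 2 * (R * (|α - α'| / α)) ^ 2 := by
  have hR : 0 ≤ R := (norm_nonneg _).trans hy'
  have h1 := h.strongly_monotone H h'.primal_mem h'.dual_nonneg
  have h2 := h'.primal y h.primal_mem
  have h3 := h'.dual ν h.dual_nonneg
  have h4 : α * (‖y' - y‖ ^ 2 + ‖ν' - ν‖ ^ 2) ≤
      (α - α') * (inner ℝ y' (y' - y) + inner ℝ ν' (ν' - ν)) := by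
    refine h1.trans ?_
    simp only [inner_sub_left, inner_sub_right, inner_add_left, real_inner_smul_left] at *
    linarith
  have h5 : (α - α') * (inner ℝ y' (y' - y) + inner ℝ ν' (ν' - ν)) ≤
      |α - α'| * (R * (‖y' - y‖ + ‖ν' - ν‖)) := by
    refine (le_abs_self _).trans ?_
    rw [abs_mul]
    refine mul_le_mul_of_nonneg_left ((abs_add_le _ _).trans ?_) (abs_nonneg _)
    rw [mul_add]
    exact add_le_add ((abs_real_inner_le_norm _ _).trans (by gcongr))
      ((abs_real_inner_le_norm _ _).trans (by gcongr))
  set p := ‖y' - y‖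
  set q := ‖ν' - ν‖
  set D := p ^ 2 + q ^ 2 with hD
  have hp : 0 ≤ p := norm_nonneg _
  have hq : 0 ≤ q := norm_nonneg _
  have hD0 : 0 ≤ D := by positivity
  have h6 : D ≤ (R * (|α - α'| / α)) * (p + q) := by
    refine le_of_mul_le_mul_left ((h4.trans h5).trans_eq ?_) hα
    field_simp
  set c := R * (|α - α'| / α)
  have h7 : (p + q) ^ 2 ≤ 2 * D := by nlinarith [sq_nonneg (p - q)]
  rcases hD0.eq_or_lt with h0 | h0
  · rw [← h0]; positivity
  · have h8 : D * D ≤ (2 * c ^ 2) * D := by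
      calc D * D ≤ (c * (p + q)) * (c * (p + q)) :=
            mul_le_mul h6 h6 hD0 (hD0.trans h6)
        _ = c ^ 2 * (p + q) ^ 2 := by ring
        _ ≤ c ^ 2 * (2 * D) := by gcongr
        _ = _ := by ring
    exact le_of_mul_le_mul_right h8 h0

/-- The gradient of `f + α/2 ‖·‖² + 1/(2α) ∑ⱼ [gⱼ]₊²` is that of the Lagrangian at the multipliers
`[g]₊/α`, so that a minimizer yields a regularized saddle point. -/
theorem exists_isRegularizedSaddle (H : IsConvexProgram f g) (hX : IsCompact X)
    (hconv : Convex ℝ X) (hne : X.Nonempty) {α : ℝ} (hα : 0 < α) :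
    ∃ p : Vec n × Vec m, IsRegularizedSaddle X f g α p.1 p.2 := by
  set Φ : Vec n → ℝ := fun x =>
    (∑ i, f i (x i)) + α / 2 * ‖x‖ ^ 2 + 1 / (2 * α) * ∑ j, max (g j x) 0 ^ 2 with hΦ
  have hd : ∀ x, HasFDerivAt Φ
      ((∑ i, (deriv (f i) (x i)) • (EuclideanSpace.proj i : Vec n →L[ℝ] ℝ)) +
        (α / 2) • (2 • innerSL ℝ x) +
        (1 / (2 * α)) • ∑ j, (2 * max (g j x) 0) • fderiv ℝ (g j) x) x := fun x => by
    refine ((HasFDerivAt.fun_sum fun i _ => ?_).add ?_).add ?_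
    · exact (H.differentiable_objective i (x i)).hasDerivAt.comp_hasFDerivAt x
        (EuclideanSpace.proj i : Vec n →L[ℝ] ℝ).hasFDerivAt
    · exact (hasStrictFDerivAt_norm_sq x).hasFDerivAt.const_mul _
    · refine (HasFDerivAt.fun_sum fun j _ => ?_).const_mul _
      exact (hasDerivAt_max_zero_sq (g j x)).comp_hasFDerivAt x
        (H.differentiable_constraint j x).hasFDerivAt
  obtain ⟨y, hy, hmin⟩ := hX.exists_isMinOn hne
    (fun x _ => (hd x).continuousAt.continuousWithinAt)
  set ν : Vec m := WithLp.toLp 2 fun j => max (g j y) 0 / α with hν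
  refine ⟨(y, ν), hy, fun j => by simp only [hν]; positivity, fun x hx => ?_, fun μ hμ => ?_⟩
  · have h := hmin.localize.hasFDerivWithinAt_nonneg (hd y).hasFDerivWithinAt
      (sub_mem_posTangentConeAt_of_segment_subset (hconv.segment_subset hy hx))
    rw [inner_add_left, inner_primalGrad, real_inner_smul_left]
    convert h using 1
    simp only [add_apply, sum_apply, smul_apply, smul_eq_mul, hν, Finset.mul_sum]
    have h2 : ∑ j, max (g j y) 0 / α * fderiv ℝ (g j) y (x - y) =
        ∑ j, 1 / (2 * α) * (2 * max (g j y) 0 * fderiv ℝ (g j) y (x - y)) :=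
      Finset.sum_congr rfl fun j _ => by field_simp
    rw [h2]
    simp
    ring
  · rw [PiLp.inner_apply]
    refine Finset.sum_nonneg fun j _ => ?_
    simp only [hν, constraintVec, PiLp.sub_apply, PiLp.smul_apply, smul_eq_mul, RCLike.inner_apply,
      conj_trivial, mul_div_cancel₀ _ hα.ne']
    rcases le_total (g j y) 0 with hg | hg
    · simp only [max_eq_right hg, zero_div, sub_zero, zero_sub]
      exact mul_nonneg (hμ j) (neg_nonneg.2 hg)
    · simp [max_eq_left hg]

theorem IsRegularizedSaddle.isSaddlePoint (H : IsConvexProgram f g) {y : Vec n} {ν : Vec m}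
    (h : IsRegularizedSaddle X f g 0 y ν) : IsSaddlePoint X f g y ν where
  primal_mem := h.primal_mem
  dual_nonneg := h.dual_nonneg
  le_dual μ hμ := by
    have := h.dual μ hμ
    rw [lagrangian_eq, lagrangian_eq]
    simp only [zero_smul, zero_sub, inner_neg_left, inner_sub_right] at this
    linarith
  le_primal x hx := by
    have h1 := h.primal x hx
    have h2 := inner_primalGrad_le H y x h.dual_nonneg
    simp only [zero_smul, add_zero] at h1
    linarith

theorem IsRegularizedSaddle.of_tendsto (H : IsConvexProgram f g) (hX : IsClosed X) {α : ℕ → ℝ}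
    {a : ℝ} (hα : Tendsto α atTop (𝓝 a)) {p : ℕ → Vec n × Vec m} {q : Vec n × Vec m}
    (hp : Tendsto p atTop (𝓝 q))
    (h : ∀ k, IsRegularizedSaddle X f g (α k) (p k).1 (p k).2) :
    IsRegularizedSaddle X f g a q.1 q.2 := by
  have h1 : Tendsto (fun k => (p k).1) atTop (𝓝 q.1) := (continuous_fst.tendsto q).comp hp
  have h2 : Tendsto (fun k => (p k).2) atTop (𝓝 q.2) := (continuous_snd.tendsto q).comp hp
  refine ⟨hX.mem_of_tendsto h1 (Eventually.of_forall fun k => (h k).primal_mem), fun j => ?_,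
    fun x hx => ?_, fun μ hμ => ?_⟩
  · have h3 : Tendsto (fun k => (p k).2 j) atTop (𝓝 (q.2 j)) :=
      ((EuclideanSpace.proj j : Vec m →L[ℝ] ℝ).continuous.tendsto q.2).comp h2
    exact ge_of_tendsto' h3 fun k => (h k).dual_nonneg j
  · exact ge_of_tendsto' (((((continuous_primalGrad H).tendsto q).comp hp).add
      (hα.smul h1)).inner (tendsto_const_nhds.sub h1)) fun k => (h k).primal x hx
  · exact ge_of_tendsto' (((hα.smul h2).sub ((H.continuous_constraintVec.tendsto q.1).comp h1)).inner
      (tendsto_const_nhds.sub h2)) fun k => (h k).dual μ hμ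

/-- Testing the primal inequality at the Slater point and the dual one at `0` gives `∑ νⱼ
(-gⱼ(xbar)) ≤ f(xbar) - f(y) + α⟨y, xbar - y⟩`. The right side is bounded on the compact set `X`,
and each coefficient `-gⱼ(xbar)` is positive. -/
theorem exists_norm_le_of_isRegularizedSaddle (H : IsConvexProgram f g) (hX : IsCompact X)
    (slater : ∃ xbar ∈ X, ∀ j, g j xbar < 0) (A : ℝ) :
    ∃ R, ∀ α y ν, 0 ≤ α → α ≤ A → IsRegularizedSaddle X f g α y ν → ‖y‖ ≤ R ∧ ‖ν‖ ≤ R := by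
  obtain ⟨xbar, hxbar, hneg⟩ := slater
  obtain ⟨R₀, hR₀⟩ := hX.isBounded.exists_norm_le
  have hcont : Continuous (objective f) := by
    have := fun i => (H.smooth_objective i).continuous
    unfold objective
    fun_prop
  obtain ⟨M, hM⟩ := hX.exists_bound_of_continuousOn hcont.continuousOn
  set C := 2 * M + A * (R₀ * (2 * R₀)) with hC
  refine ⟨max R₀ √(∑ j, (C / (-g j xbar)) ^ 2), fun α y ν hα hαA h =>
    ⟨(hR₀ y h.primal_mem).trans (le_max_left _ _), le_max_of_le_right ?_⟩⟩
  have h1 := h.primal xbar hxbar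
  have h2 := h.dual 0 fun j => by simp
  have h3 := inner_primalGrad_le H y xbar h.dual_nonneg
  have hobj : objective f xbar - objective f y ≤ 2 * M := by
    have h4 := (abs_le.1 (hM _ hxbar)).2
    have h5 := (abs_le.1 (hM _ h.primal_mem)).1
    linarith
  have hin : α * inner ℝ y (xbar - y) ≤ A * (R₀ * (2 * R₀)) := by
    have hR₀' := hR₀ y h.primal_mem
    have h0 : 0 ≤ R₀ := (norm_nonneg _).trans hR₀'
    have h4 : ‖xbar - y‖ ≤ 2 * R₀ := (norm_sub_le _ _).trans (by linarith [hR₀ _ hxbar])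
    calc α * inner ℝ y (xbar - y) ≤ α * (R₀ * (2 * R₀)) := by
          refine mul_le_mul_of_nonneg_left ((real_inner_le_norm _ _).trans ?_) hα
          gcongr
      _ ≤ _ := by gcongr
  have hsum : ∑ j, ν j * (-g j xbar) ≤ C := by
    rw [lagrangian_eq, lagrangian_eq] at h3
    rw [zero_sub, inner_neg_right, inner_sub_left, real_inner_smul_left,
      real_inner_self_eq_norm_sq] at h2
    rw [inner_add_left, real_inner_smul_left] at h1
    have h4 := inner_constraintVec (g := g) xbar ν
    have h5 : ∑ j, ν j * (-g j xbar) = - inner ℝ (constraintVec g xbar) ν := by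
      rw [h4, ← Finset.sum_neg_distrib]
      exact Finset.sum_congr rfl fun j _ => by ring
    have h6 : 0 ≤ α * ‖ν‖ ^ 2 := by positivity
    rw [h5]
    linarith
  rw [EuclideanSpace.norm_eq]
  refine Real.sqrt_le_sqrt (Finset.sum_le_sum fun j _ => ?_)
  rw [Real.norm_eq_abs, sq_abs]
  refine pow_le_pow_left₀ (h.dual_nonneg j) ?_ 2
  have hj := hneg j
  rw [le_div_iff₀ (by linarith)]
  exact (Finset.single_le_sum (f := fun j => ν j * (-g j xbar))
    (fun i _ => mul_nonneg (h.dual_nonneg i) (by linarith [hneg i])) (Finset.mem_univ j)).trans hsum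

theorem exists_subseq_tendsto_isSaddlePoint (H : IsConvexProgram f g) (hX : IsCompact X)
    (slater : ∃ xbar ∈ X, ∀ j, g j xbar < 0) {α : ℕ → ℝ} (hα0 : ∀ k, 0 ≤ α k)
    (hα : Tendsto α atTop (𝓝 0)) {p : ℕ → Vec n × Vec m}
    (h : ∀ k, IsRegularizedSaddle X f g (α k) (p k).1 (p k).2) :
    ∃ q : Vec n × Vec m, IsSaddlePoint X f g q.1 q.2 ∧
      ∃ φ : ℕ → ℕ, StrictMono φ ∧ Tendsto (p ∘ φ) atTop (𝓝 q) := by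
  obtain ⟨A, hA⟩ := hα.bddAbove_range
  obtain ⟨R, hR⟩ := exists_norm_le_of_isRegularizedSaddle H hX slater A
  have hmem : ∀ k, p k ∈ Metric.closedBall (0 : Vec n × Vec m) R := fun k => by
    obtain ⟨h1, h2⟩ := hR (α k) _ _ (hα0 k) (hA ⟨k, rfl⟩) (h k)
    simp [Prod.norm_def, h1, h2]
  obtain ⟨q, -, φ, hφ, hq⟩ := (isCompact_closedBall (0 : Vec n × Vec m) R).tendsto_subseq hmem
  exact ⟨q, (IsRegularizedSaddle.of_tendsto H hX.isClosed (hα.comp hφ.tendsto_atTop) hq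
    fun k => h (φ k)).isSaddlePoint H, φ, hφ, hq⟩

/-- Every subsequence has a further one that converges to some saddle point, and there is only one
candidate. -/
theorem tendsto_regularizedSaddle (H : IsConvexProgram f g) (hX : IsCompact X)
    (slater : ∃ xbar ∈ X, ∀ j, g j xbar < 0) {α : ℕ → ℝ} (hα0 : ∀ k, 0 ≤ α k)
    (hα : Tendsto α atTop (𝓝 0)) {p : ℕ → Vec n × Vec m}
    (h : ∀ k, IsRegularizedSaddle X f g (α k) (p k).1 (p k).2) {q : Vec n × Vec m}
    (huniq : ∀ x μ, IsSaddlePoint X f g x μ → x = q.1 ∧ μ = q.2) : Tendsto p atTop (𝓝 q) := by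
  refine tendsto_of_subseq_tendsto fun ns hns => ?_
  obtain ⟨q', hq', φ, -, ht⟩ := exists_subseq_tendsto_isSaddlePoint H hX slater
    (fun k => hα0 (ns k)) (hα.comp hns) (p := p ∘ ns) fun k => h (ns k)
  obtain ⟨h1, h2⟩ := huniq _ _ hq'
  exact ⟨φ, by rwa [show q' = q from Prod.ext h1 h2] at ht⟩

theorem exists_isSaddlePoint (H : IsConvexProgram f g) (hX : IsCompact X) (hconv : Convex ℝ X)
    (slater : ∃ xbar ∈ X, ∀ j, g j xbar < 0) : ∃ x μ, IsSaddlePoint X f g x μ := by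
  have hne : X.Nonempty := slater.imp fun _ h => h.1
  choose p hp using fun k : ℕ => exists_isRegularizedSaddle H hX hconv hne
    (Nat.one_div_pos_of_nat (α := ℝ) (n := k))
  obtain ⟨q, hq, -⟩ := exists_subseq_tendsto_isSaddlePoint H hX slater
    (fun k => (Nat.one_div_pos_of_nat (α := ℝ) (n := k)).le)
    tendsto_one_div_add_atTop_nhds_zero_nat hp
  exact ⟨q.1, q.2, hq⟩

/-! ### Uniqueness of the saddle point -/

theorem IsSaddlePoint.constraint_nonpos {x : Vec n} {μ : Vec m} (h : IsSaddlePoint X f g x μ)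
    (j : Fin m) : g j x ≤ 0 := by
  -- Raising the `j`-th multiplier by one cannot increase `L`.
  have h1 := h.le_dual (μ + EuclideanSpace.single j 1) fun i => by
    have := h.dual_nonneg i
    by_cases hij : i = j <;> simp [hij] <;> linarith [h.dual_nonneg j]
  rw [lagrangian_eq, lagrangian_eq, inner_add_right] at h1
  simpa [constraintVec, EuclideanSpace.inner_single_right] using h1

theorem IsSaddlePoint.mul_eq_zero {x : Vec n} {μ : Vec m} (h : IsSaddlePoint X f g x μ)
    (j : Fin m) : μ j * g j x = 0 := by
  have h1 := h.le_dual 0 fun i => by simp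
  have hle : ∀ i ∈ Finset.univ, μ i * g i x ≤ 0 := fun i _ =>
    mul_nonpos_of_nonneg_of_nonpos (h.dual_nonneg i) (h.constraint_nonpos i)
  simp only [lagrangian, PiLp.zero_apply, zero_mul, Finset.sum_const_zero] at h1
  have h2 : ∑ i, μ i * g i x = 0 := le_antisymm (Finset.sum_nonpos hle) (by linarith)
  exact (Finset.sum_eq_zero_iff_of_nonpos hle).1 h2 j (Finset.mem_univ j)

theorem IsSaddlePoint.eq_of_isUniqueConstrainedMin {x xhat : Vec n} {μ : Vec m}
    (h : IsSaddlePoint X f g x μ) (hmin : IsUniqueConstrainedMin X f g xhat) : x = xhat := by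
  by_contra hne
  have h1 := hmin.2 x ⟨h.primal_mem, h.constraint_nonpos⟩ hne
  have h2 := h.le_primal xhat hmin.1.1
  simp only [lagrangian, h.mul_eq_zero, Finset.sum_const_zero] at h2
  have h3 : ∑ j, μ j * g j xhat ≤ 0 := Finset.sum_nonpos fun j _ =>
    mul_nonpos_of_nonneg_of_nonpos (h.dual_nonneg j) (hmin.1.2 j)
  linarith

theorem IsSaddlePoint.primalGrad_eq_zero (H : IsConvexProgram f g) {x : Vec n} {μ : Vec m}
    (h : IsSaddlePoint X f g x μ) (hx : x ∈ interior X) : primalGrad f g x μ = 0 := by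
  have hd : HasFDerivAt (fun z => lagrangian f g z μ)
      ((∑ i, (deriv (f i) (x i)) • (EuclideanSpace.proj i : Vec n →L[ℝ] ℝ)) +
        ∑ j, μ j • fderiv ℝ (g j) x) x := by
    refine (HasFDerivAt.fun_sum fun i _ => ?_).add (HasFDerivAt.fun_sum fun j _ => ?_)
    · exact (H.differentiable_objective i (x i)).hasDerivAt.comp_hasFDerivAt x
        (EuclideanSpace.proj i : Vec n →L[ℝ] ℝ).hasFDerivAt
    · exact (H.differentiable_constraint j x).hasFDerivAt.const_mul _
  have hmin : IsLocalMin (fun z => lagrangian f g z μ) x := by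
    filter_upwards [mem_interior_iff_mem_nhds.1 hx] with z hz using h.le_primal z hz
  have h0 := hmin.hasFDerivAt_eq_zero hd
  refine ext_inner_right ℝ fun v => ?_
  have hv := congrArg (fun φ : Vec n →L[ℝ] ℝ => φ v) h0
  rw [inner_primalGrad, inner_zero_left]
  simpa using hv

/-- Both multipliers vanish at inactive constraints and make the gradient of `L` vanish. Their
difference is therefore a linear relation among the active gradients. -/
theorem IsSaddlePoint.eq_of_isRegularPoint (H : IsConvexProgram f g) {x : Vec n} {μ μ' : Vec m}
    (h : IsSaddlePoint X f g x μ) (h' : IsSaddlePoint X f g x μ') (hx : x ∈ interior X)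
    (hreg : IsRegularPoint g x) : μ = μ' := by
  classical
  have hinact : ∀ j, g j x ≠ 0 → μ j = 0 ∧ μ' j = 0 := fun j hj =>
    ⟨(_root_.mul_eq_zero.1 (h.mul_eq_zero j)).resolve_right hj,
      (_root_.mul_eq_zero.1 (h'.mul_eq_zero j)).resolve_right hj⟩
  have hsum : ∑ j, (μ j - μ' j) • gradient (g j) x = 0 := by
    refine ext_inner_right ℝ fun v => ?_
    have h1 := inner_primalGrad (f := f) (g := g) x μ v
    have h2 := inner_primalGrad (f := f) (g := g) x μ' v
    rw [h.primalGrad_eq_zero H hx, inner_zero_left] at h1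
    rw [h'.primalGrad_eq_zero H hx, inner_zero_left] at h2
    simp only [sum_inner, real_inner_smul_left, gradient, InnerProductSpace.toDual_symm_apply,
      inner_zero_left, sub_mul, Finset.sum_sub_distrib]
    linarith
  have hact : ∑ j : {j : Fin m // g j x = 0}, (μ j - μ' j) • gradient (g j) x = 0 := by
    rw [← hsum, ← Finset.sum_filter_of_ne (p := fun j => g j x = 0)]
    · exact (Finset.sum_subtype _ (by simp) fun j => (μ j - μ' j) • gradient (g j) x).symm
    · intro j _ hj
      contrapose! hj
      rw [(hinact j hj).1, (hinact j hj).2, sub_self, zero_smul]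
  ext j
  by_cases hj : g j x = 0
  · exact sub_eq_zero.1 (Fintype.linearIndependent_iff.1 hreg
      (fun j => μ j - μ' j) hact ⟨j, hj⟩)
  · rw [(hinact j hj).1, (hinact j hj).2]

/-! ### Growth -/

theorem exists_norm_primalGrad_sq_le (H : IsConvexProgram f g) (hX : IsCompact X) :
    ∃ C, 0 ≤ C ∧ ∀ x ∈ X, ∀ μ : Vec m, ‖primalGrad f g x μ‖ ^ 2 ≤ C * (1 + ‖μ‖ ^ 2) := by
  have h1 : ∀ i, ∃ c, ∀ x ∈ X, ‖deriv (f i) (x i)‖ ≤ c := fun i =>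
    hX.exists_bound_of_continuousOn
      ((H.continuous_deriv_objective i).comp (by fun_prop)).continuousOn
  have h2 : ∀ i, ∃ c, ∀ x ∈ X, ‖constraintPartial g i x‖ ≤ c := fun i =>
    hX.exists_bound_of_continuousOn (H.continuous_constraintPartial i).continuousOn
  choose c hc using h1
  choose d hd using h2
  refine ⟨∑ i, (2 * c i ^ 2 + 2 * d i ^ 2), Finset.sum_nonneg fun i _ => by positivity,
    fun x hx μ => ?_⟩
  rw [EuclideanSpace.norm_sq_eq, Finset.sum_mul]
  refine Finset.sum_le_sum fun i _ => ?_
  have h3 := hc i x hx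
  have h4 : |inner ℝ (constraintPartial g i x) μ| ≤ d i * ‖μ‖ :=
    (abs_real_inner_le_norm _ _).trans (by gcongr; exact hd i x hx)
  have h5 : deriv (f i) (x i) ^ 2 ≤ c i ^ 2 := sq_le_sq' (abs_le.1 h3).1 (abs_le.1 h3).2
  have h6 : inner ℝ (constraintPartial g i x) μ ^ 2 ≤ (d i * ‖μ‖) ^ 2 :=
    sq_le_sq' (abs_le.1 h4).1 (abs_le.1 h4).2
  simp only [primalGrad, Real.norm_eq_abs, sq_abs]
  have h7 := add_sq_le (a := deriv (f i) (x i)) (b := inner ℝ (constraintPartial g i x) μ)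
  have h8 : 0 ≤ c i ^ 2 * ‖μ‖ ^ 2 := by positivity
  nlinarith [sq_nonneg (d i)]

end Program

/-! ### A recursive inequality -/

/-- Once `s k ≤ (a / 2) * r k`, the quantity `e k - a / 2` satisfies the recursion without the error
term. Then `1 - r ≤ exp (-r)` bounds it by the exponential of minus the divergent partial sums. -/
theorem tendsto_zero_of_le_one_sub_mul_add {e r s : ℕ → ℝ} (he : ∀ k, 0 ≤ e k)
    (hr : ∀ᶠ k in atTop, r k ≤ 1)
    (hrec : ∀ᶠ k in atTop, e (k + 1) ≤ (1 - r k) * e k + s k)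
    (hdiv : Tendsto (fun N => ∑ k ∈ Finset.range N, r k) atTop atTop)
    (hs : ∀ η > 0, ∀ᶠ k in atTop, s k ≤ η * r k) : Tendsto e atTop (𝓝 0) := by
  rw [tendsto_order]
  refine ⟨fun a ha => Eventually.of_forall fun k => ha.trans_le (he k), fun a ha => ?_⟩
  obtain ⟨N, hN⟩ := eventually_atTop.1 ((hr.and hrec).and (hs (a / 2) (half_pos ha)))
  set S : ℕ → ℝ := fun N => ∑ k ∈ Finset.range N, r k
  -- The absolute value keeps the majorant nonnegative, so that `1 - r k` may be replaced by `exp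
  -- (-r k)`.
  set D := |e N - a / 2|
  have hbound : ∀ k ≥ N, e k - a / 2 ≤ D * Real.exp (-(S k - S N)) := by
    intro k hk
    induction k, hk using Nat.le_induction with
    | base => simpa using le_abs_self (e N - a / 2)
    | succ k hk ih =>
      obtain ⟨⟨h1, h2⟩, h3⟩ := hN k hk
      have h4 : e (k + 1) - a / 2 ≤ (1 - r k) * (e k - a / 2) := by linarith
      have h5 : (1 - r k) * (e k - a / 2) ≤ (1 - r k) * (D * Real.exp (-(S k - S N))) :=
        mul_le_mul_of_nonneg_left ih (by linarith)
      have h6 : 1 - r k ≤ Real.exp (-r k) := by linarith [Real.add_one_le_exp (-r k)]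
      have h7 : (1 - r k) * (D * Real.exp (-(S k - S N))) ≤
          Real.exp (-r k) * (D * Real.exp (-(S k - S N))) := by gcongr
      refine (h4.trans (h5.trans h7)).trans_eq ?_
      have h8 : S (k + 1) = S k + r k := Finset.sum_range_succ _ _
      rw [h8, mul_left_comm, ← Real.exp_add]
      congr 2
      ring
  have hlim : Tendsto (fun k => D * Real.exp (-(S k - S N))) atTop (𝓝 0) := by
    have h1 : Tendsto (fun k => -(S k - S N)) atTop atBot :=
      tendsto_neg_atTop_atBot.comp (tendsto_atTop_add_const_right _ (-S N) hdiv)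
    simpa using (Real.tendsto_exp_atBot.comp h1).const_mul D
  filter_upwards [hlim.eventually (gt_mem_nhds (half_pos ha)), eventually_ge_atTop N] with k h1 h2
  linarith [hbound k h2]

/-! ### Power step sizes -/

theorem powerSeq_of_ne_zero (v₀ a c : ℝ) {k : ℕ} (hk : k ≠ 0) :
    powerSeq v₀ a c k = a * (k : ℝ) ^ (-c) := if_neg hk

theorem powerSeq_pos {v₀ a c : ℝ} (ha : 0 < a) {k : ℕ} (hk : k ≠ 0) : 0 < powerSeq v₀ a c k := by
  rw [powerSeq_of_ne_zero _ _ _ hk]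
  have : (0 : ℝ) < k := by positivity
  positivity

theorem tendsto_natCast_rpow_neg {c : ℝ} (hc : 0 < c) :
    Tendsto (fun k : ℕ => (k : ℝ) ^ (-c)) atTop (𝓝 0) :=
  (tendsto_rpow_neg_atTop hc).comp tendsto_natCast_atTop_atTop

theorem tendsto_powerSeq {v₀ a c : ℝ} (hc : 0 < c) :
    Tendsto (powerSeq v₀ a c) atTop (𝓝 0) := by
  have h := (tendsto_natCast_rpow_neg hc).const_mul a
  rw [mul_zero] at h
  refine h.congr' ?_
  filter_upwards [eventually_ne_atTop 0] with k hk using (powerSeq_of_ne_zero _ _ _ hk).symm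

/-- The quotient equals `1 - (k/(k+1))^c`, and `c ≤ 1` bounds it by `1 - k/(k+1)`. -/
theorem abs_powerSeq_sub_div_le {v₀ a c : ℝ} (ha : 0 < a) (hc0 : 0 ≤ c) (hc1 : c ≤ 1) {k : ℕ}
    (hk : k ≠ 0) :
    |powerSeq v₀ a c k - powerSeq v₀ a c (k + 1)| / powerSeq v₀ a c k ≤ 1 / k := by
  have hk0 : (0 : ℝ) < k := by positivity
  have hk1 : (0 : ℝ) < k + 1 := by positivity
  rw [powerSeq_of_ne_zero _ _ _ hk, powerSeq_of_ne_zero _ _ _ k.succ_ne_zero, ← mul_sub, abs_mul,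
    abs_of_pos ha, mul_div_mul_left _ _ ha.ne']
  push_cast
  have h1 : ((k : ℝ) + 1) ^ (-c) ≤ (k : ℝ) ^ (-c) :=
    Real.rpow_le_rpow_of_nonpos hk0 (by linarith) (by linarith)
  rw [abs_of_nonneg (by linarith), sub_div, div_self (by positivity),
    ← Real.div_rpow hk1.le hk0.le, Real.rpow_neg (by positivity), ← Real.inv_rpow (by positivity),
    inv_div]
  have h2 : (k : ℝ) / (k + 1) ≤ ((k : ℝ) / (k + 1)) ^ c := by
    conv_lhs => rw [← Real.rpow_one ((k : ℝ) / (k + 1))]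
    exact Real.rpow_le_rpow_of_exponent_ge (by positivity)
      ((div_le_one hk1).2 (by linarith)) hc1
  have h3 : 1 - (k : ℝ) / (k + 1) = 1 / (k + 1) := by field_simp; ring
  have h4 : 1 / ((k : ℝ) + 1) ≤ 1 / k := one_div_le_one_div_of_le hk0 (by linarith)
  linarith

theorem tendsto_zero_of_powerSeq_recursion {γ₀ α₀ a b c₁ c₂ : ℝ} (ha : 0 < a) (hb : 0 < b)
    (hc₂ : 0 < c₂) (hc : c₂ < c₁) (hc₁ : c₁ + c₂ < 1) {e : ℕ → ℝ} (he : ∀ k, 0 ≤ e k) {C D : ℝ}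
    (hC : 0 ≤ C) (hD : 0 ≤ D)
    (hrec : ∀ k, k ≠ 0 → e (k + 1) ≤
      (1 + powerSeq γ₀ a c₁ k * powerSeq α₀ b c₂ k) *
        ((1 - 2 * (powerSeq γ₀ a c₁ k * powerSeq α₀ b c₂ k) + C * powerSeq γ₀ a c₁ k ^ 2) * e k +
          C * powerSeq γ₀ a c₁ k ^ 2) +
      (1 + 1 / (powerSeq γ₀ a c₁ k * powerSeq α₀ b c₂ k)) * (D * (1 / k) ^ 2)) :
    Tendsto e atTop (𝓝 0) := by
  set γ := powerSeq γ₀ a c₁ with hγ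
  set α := powerSeq α₀ b c₂ with hα
  have hγ0 : ∀ k, k ≠ 0 → 0 < γ k := fun k hk => powerSeq_pos ha hk
  have hα0 : ∀ k, k ≠ 0 → 0 < α k := fun k hk => powerSeq_pos hb hk
  have hρ : ∀ k, k ≠ 0 → γ k * α k = a * b * (k : ℝ) ^ (-(c₁ + c₂)) := fun k hk => by
    have : (0 : ℝ) < k := by positivity
    rw [hγ, hα, powerSeq_of_ne_zero _ _ _ hk, powerSeq_of_ne_zero _ _ _ hk, neg_add,
      Real.rpow_add this]
    ring
  have hρ1 : ∀ᶠ k in atTop, γ k * α k ≤ 1 := by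
    have h := (tendsto_powerSeq (v₀ := γ₀) (a := a) (hc₂.trans hc)).mul
      (tendsto_powerSeq (v₀ := α₀) (a := b) hc₂)
    rw [mul_zero] at h
    exact h.eventually (ge_mem_nhds one_pos)
  have hratio : ∀ η > 0, ∀ᶠ k in atTop, γ k ^ 2 ≤ η * (γ k * α k) := fun η hη => by
    have h := (tendsto_natCast_rpow_neg (sub_pos.2 hc)).eventually
      (ge_mem_nhds (show 0 < η * b / a by positivity))
    filter_upwards [h, eventually_ne_atTop 0] with k hk hk0
    have hkp : (0 : ℝ) < k := by positivity
    have h1 : γ k ≤ η * α k := by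
      rw [hγ, hα, powerSeq_of_ne_zero _ _ _ hk0, powerSeq_of_ne_zero _ _ _ hk0]
      rw [le_div_iff₀' ha] at hk
      have h2 : (k : ℝ) ^ (-c₁) = (k : ℝ) ^ (-(c₁ - c₂)) * (k : ℝ) ^ (-c₂) := by
        rw [← Real.rpow_add hkp]; congr 1; ring
      have h3 : 0 ≤ (k : ℝ) ^ (-c₂) := by positivity
      rw [h2]
      nlinarith
    nlinarith [hγ0 k hk0]
  have hlarge : ∀ η > 0, ∀ᶠ k : ℕ in atTop, (1 / k : ℝ) ^ 2 ≤ η * (γ k * α k) ^ 2 := fun η hη => by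
    have h := (tendsto_natCast_rpow_neg (c := 1 - (c₁ + c₂)) (by linarith)).eventually
      (ge_mem_nhds (show 0 < √η * (a * b) by positivity))
    filter_upwards [h, eventually_ne_atTop 0] with k hk hk0
    have hkp : (0 : ℝ) < k := by positivity
    have h1 : 1 / (k : ℝ) ≤ √η * (γ k * α k) := by
      rw [hρ k hk0]
      have h2 : 1 / (k : ℝ) = (k : ℝ) ^ (-(1 - (c₁ + c₂))) * (k : ℝ) ^ (-(c₁ + c₂)) := by
        rw [← Real.rpow_add hkp, one_div, ← Real.rpow_neg_one]; congr 1; ring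
      have h3 : 0 ≤ (k : ℝ) ^ (-(c₁ + c₂)) := by positivity
      rw [h2]
      nlinarith
    calc (1 / k : ℝ) ^ 2 ≤ (√η * (γ k * α k)) ^ 2 := by gcongr
      _ = _ := by rw [mul_pow, Real.sq_sqrt hη.le]
  -- The shift by one avoids the arbitrary values of the step sizes at time `0`.
  rw [← tendsto_add_atTop_iff_nat 1]
  refine tendsto_zero_of_le_one_sub_mul_add (r := fun k => γ (k + 1) * α (k + 1) / 2)
    (s := fun k => 2 * C * γ (k + 1) ^ 2 +
      (1 + 1 / (γ (k + 1) * α (k + 1))) * (D * (1 / (k + 1 : ℕ)) ^ 2)) (fun k => he _) ?_ ?_ ?_ ?_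
  · filter_upwards [(tendsto_add_atTop_nat 1).eventually hρ1] with k hk
    linarith
  · have h := hratio (1 / (2 * (C + 1))) (by positivity)
    filter_upwards [(tendsto_add_atTop_nat 1).eventually hρ1,
      (tendsto_add_atTop_nat 1).eventually h] with k hk1 hk2
    refine (hrec (k + 1) k.succ_ne_zero).trans ?_
    have hp := mul_pos (hγ0 (k + 1) k.succ_ne_zero) (hα0 (k + 1) k.succ_ne_zero)
    set ρ := γ (k + 1) * α (k + 1)
    set q := γ (k + 1) ^ 2
    have hq : 0 ≤ q := sq_nonneg _
    have h1 : C * q ≤ ρ / 2 := by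
      rw [one_div_mul_eq_div, le_div_iff₀ (by positivity)] at hk2
      nlinarith
    have h2 : (1 + ρ) * (1 - 2 * ρ + C * q) ≤ 1 - ρ / 2 := by nlinarith
    have h3 := mul_le_mul_of_nonneg_right h2 (he (k + 1))
    have h4 : (1 + ρ) * (C * q) ≤ 2 * C * q := by nlinarith [mul_nonneg hC hq]
    linarith
  · have hns : ¬ Summable fun k : ℕ => γ (k + 1) * α (k + 1) / 2 := by
      have : (fun k : ℕ => γ (k + 1) * α (k + 1) / 2) =
          fun k : ℕ => a * b / 2 * ((k + 1 : ℕ) : ℝ) ^ (-(c₁ + c₂)) := by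
        ext k
        rw [hρ _ k.succ_ne_zero]
        ring
      rw [this, summable_mul_left_iff (by positivity),
        summable_nat_add_iff 1 (f := fun k : ℕ => (k : ℝ) ^ (-(c₁ + c₂))), Real.summable_nat_rpow]
      linarith
    refine (not_summable_iff_tendsto_nat_atTop_of_nonneg fun k => ?_).1 hns
    have := mul_pos (hγ0 (k + 1) k.succ_ne_zero) (hα0 (k + 1) k.succ_ne_zero)
    positivity
  · intro η hη
    -- Each of the two error terms is to be at most `η ρ / 4`, half of `η r`.
    have h1 := hratio (η / (8 * (C + 1))) (by positivity)
    have h2 := hlarge (η / (8 * (D + 1))) (by positivity)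
    filter_upwards [(tendsto_add_atTop_nat 1).eventually hρ1,
      (tendsto_add_atTop_nat 1).eventually h1, (tendsto_add_atTop_nat 1).eventually h2]
      with k hk1 hk2 hk3
    have hp := mul_pos (hγ0 (k + 1) k.succ_ne_zero) (hα0 (k + 1) k.succ_ne_zero)
    set ρ := γ (k + 1) * α (k + 1)
    have h3 : 2 * C * γ (k + 1) ^ 2 ≤ η * ρ / 4 := by
      rw [div_mul_eq_mul_div, le_div_iff₀ (by positivity)] at hk2
      nlinarith [sq_nonneg (γ (k + 1))]
    have h4 : D * (1 / (k + 1 : ℕ) : ℝ) ^ 2 ≤ η / 8 * ρ ^ 2 := by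
      rw [div_mul_eq_mul_div, le_div_iff₀ (by positivity)] at hk3
      nlinarith [sq_nonneg (1 / (k + 1 : ℕ) : ℝ)]
    have h5 : 1 + 1 / ρ ≤ 2 / ρ := by
      rw [le_div_iff₀ hp, add_mul, one_div_mul_cancel hp.ne']
      linarith
    have h6 : (1 + 1 / ρ) * (D * (1 / (k + 1 : ℕ) : ℝ) ^ 2) ≤ 2 / ρ * (η / 8 * ρ ^ 2) := by
      gcongr
    have h7 : 2 / ρ * (η / 8 * ρ ^ 2) = η * ρ / 4 := by field_simp; ring
    linarith

/-! ### Moments of the noise -/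

section Noise

variable {m : ℕ} {Ω : Type*} [MeasurableSpace Ω] {P : Measure Ω}

theorem memLp_two_of_hasLaw_gaussian {W : Ω → Vec m} {S : Matrix (Fin m) (Fin m) ℝ}
    (hW : HasLaw W (multivariateGaussian 0 S) P) : MemLp W 2 P := by
  have h : MemLp id 2 (P.map W) := by
    rw [hW.map_eq]; exact IsGaussian.memLp_two_id
  exact (memLp_map_measure_iff aestronglyMeasurable_id hW.aemeasurable).1 h

theorem integral_apply_of_hasLaw_gaussian {W : Ω → Vec m} {S : Matrix (Fin m) (Fin m) ℝ}
    (hW : HasLaw W (multivariateGaussian 0 S) P) (j : Fin m) : ∫ ω, W ω j ∂P = 0 := by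
  have h1 : ∫ ω, W ω j ∂P = ∫ x, (EuclideanSpace.proj j : Vec m →L[ℝ] ℝ) x
      ∂(multivariateGaussian 0 S) := by
    rw [← hW.map_eq, integral_map hW.aemeasurable (by fun_prop)]
    rfl
  have h2 := (EuclideanSpace.proj j : Vec m →L[ℝ] ℝ).integral_comp_comm
    (IsGaussian.integrable_id (μ := multivariateGaussian (0 : Vec m) S))
  simp only [id_eq, integral_id_multivariateGaussian, map_zero] at h2
  exact h1.trans h2

theorem integral_norm_sq_of_hasLaw_gaussian [IsProbabilityMeasure P] {W : Ω → Vec m} {s : ℝ}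
    (hW : HasLaw W (multivariateGaussian 0 (s ^ 2 • 1)) P) :
    ∫ ω, ‖W ω‖ ^ 2 ∂P = m * s ^ 2 := by
  have hps : (s ^ 2 • (1 : Matrix (Fin m) (Fin m) ℝ)).PosSemidef :=
    Matrix.PosSemidef.one.smul (sq_nonneg s)
  have hj : ∀ j, ∫ ω, W ω j ^ 2 ∂P = s ^ 2 := fun j => by
    have h1 := variance_eval_multivariateGaussian (μ := (0 : Vec m)) hps j
    rw [← hW.map_eq, variance_map (by fun_prop) hW.aemeasurable, variance_of_integral_eq_zero] at h1
    · simpa [Function.comp_def] using h1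
    · exact (by fun_prop : Measurable fun x : Vec m => x j).comp_aemeasurable hW.aemeasurable
    · exact integral_apply_of_hasLaw_gaussian hW j
  simp_rw [EuclideanSpace.real_norm_sq_eq]
  rw [integral_finsetSum]
  · simp [hj]
  · intro j _
    exact ((memLp_two_of_hasLaw_gaussian hW).eval_piLp j).integrable_sq

/-- Independence replaces square integrability. This matters for `U = (x - y)ᵢ μ`, whose
integrability comes from its being a product of two `L²` functions. -/
theorem integrable_inner_of_indepFun {U W : Ω → Vec m} (h : IndepFun U W P) (hU : Integrable U P)
    (hW : Integrable W P) : Integrable (fun ω => inner ℝ (W ω) (U ω)) P := by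
  simp_rw [PiLp.inner_apply]
  refine integrable_finsetSum _ fun j _ => ?_
  have hj : IndepFun (fun ω => U ω j) (fun ω => W ω j) P :=
    h.comp (φ := fun x : Vec m => x j) (ψ := fun x : Vec m => x j) (by fun_prop) (by fun_prop)
  exact (hj.integrable_mul (hU.eval_piLp j) (hW.eval_piLp j)).congr (ae_of_all _ fun ω => by simp)

theorem integral_inner_eq_zero_of_indepFun {U W : Ω → Vec m} (h : IndepFun U W P)
    (hU : Integrable U P) (hW : Integrable W P) (h0 : ∀ j, ∫ ω, W ω j ∂P = 0) :
    ∫ ω, inner ℝ (W ω) (U ω) ∂P = 0 := by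
  have hj : ∀ j, IndepFun (fun ω => U ω j) (fun ω => W ω j) P := fun j =>
    h.comp (φ := fun x : Vec m => x j) (ψ := fun x : Vec m => x j) (by fun_prop) (by fun_prop)
  simp_rw [PiLp.inner_apply]
  rw [integral_finsetSum]
  · refine Finset.sum_eq_zero fun j _ => ?_
    have := (hj j).integral_fun_mul_eq_mul_integral (hU.eval_piLp j).aestronglyMeasurable
      (hW.eval_piLp j).aestronglyMeasurable
    simpa [h0] using this
  · intro j _
    exact ((hj j).integrable_mul (hU.eval_piLp j) (hW.eval_piLp j)).congr
      (ae_of_all _ fun ω => by simp)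

/-- Cauchy–Schwarz pointwise, then independence factors the expectation; no fourth moments are
needed. -/
theorem integrable_inner_sq_and_integral_le {U W : Ω → Vec m} (h : IndepFun U W P)
    (hU : MemLp U 2 P) (hW : MemLp W 2 P) :
    Integrable (fun ω => inner ℝ (W ω) (U ω) ^ 2) P ∧
      ∫ ω, inner ℝ (W ω) (U ω) ^ 2 ∂P ≤ (∫ ω, ‖W ω‖ ^ 2 ∂P) * ∫ ω, ‖U ω‖ ^ 2 ∂P := by
  have hU2 : Integrable (fun ω => ‖U ω‖ ^ 2) P := hU.norm.integrable_sq
  have hW2 : Integrable (fun ω => ‖W ω‖ ^ 2) P := hW.norm.integrable_sq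
  have hi : IndepFun (fun ω => ‖W ω‖ ^ 2) (fun ω => ‖U ω‖ ^ 2) P :=
    (h.comp (φ := fun x : Vec m => ‖x‖ ^ 2) (ψ := fun x : Vec m => ‖x‖ ^ 2) (by fun_prop)
      (by fun_prop)).symm
  have hint : Integrable (fun ω => ‖W ω‖ ^ 2 * ‖U ω‖ ^ 2) P := hi.integrable_mul hW2 hU2
  have hle : ∀ ω, inner ℝ (W ω) (U ω) ^ 2 ≤ ‖W ω‖ ^ 2 * ‖U ω‖ ^ 2 := fun ω => by
    rw [← mul_pow]
    have := abs_le.1 (abs_real_inner_le_norm (W ω) (U ω))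
    exact sq_le_sq' this.1 this.2
  have hint2 : Integrable (fun ω => inner ℝ (W ω) (U ω) ^ 2) P := by
    refine hint.mono' ((hW.aestronglyMeasurable.inner hU.aestronglyMeasurable).pow 2)
      (ae_of_all _ fun ω => ?_)
    rw [Real.norm_of_nonneg (sq_nonneg _)]
    exact hle ω
  refine ⟨hint2, (integral_mono hint2 hint hle).trans_eq ?_⟩
  exact hi.integral_fun_mul_eq_mul_integral hW2.aestronglyMeasurable hU2.aestronglyMeasurable

end Noise

/-! ### One step of the algorithm -/

theorem norm_cloudStep_sub_le {m : ℕ} (γ α : ℝ) (μ G : Vec m) {ν : Vec m} (hν : ∀ j, 0 ≤ ν j) :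
    ‖cloudStep γ α μ G - ν‖ ≤ ‖μ + γ • (G - α • μ) - ν‖ := by
  rw [EuclideanSpace.norm_eq, EuclideanSpace.norm_eq]
  refine Real.sqrt_le_sqrt (Finset.sum_le_sum fun j _ => ?_)
  refine pow_le_pow_left₀ (norm_nonneg _) ?_ 2
  have := abs_max_sub_max_le_abs (μ j + γ * (G j - α * μ j)) (ν j) 0
  rw [max_eq_left (hν j)] at this
  simpa [cloudStep] using this

/-- The effect of the noises on the gradient: the vector of the `wᵢᵀ μ`. -/
noncomputable def gradNoise {n m : ℕ} (w : Fin n → Vec m) (μ : Vec m) : Vec n :=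
  WithLp.toLp 2 fun i => inner ℝ (w i) μ

theorem toLp_agentStep {n m : ℕ} (f : Fin n → ℝ → ℝ) (g : Fin m → Vec n → ℝ) (γ α : ℝ) (x : Vec n)
    (μ : Vec m) (w : Fin n → Vec m) :
    (WithLp.toLp 2 fun i => agentStep γ α (f i) (x i) (noisyPartial g i x (w i)) μ) =
      x - γ • (primalGrad f g x μ + α • x + gradNoise w μ) := by
  ext i
  simp only [agentStep, noisyPartial, primalGrad, gradNoise, inner_add_left, PiLp.sub_apply,
    PiLp.smul_apply, PiLp.add_apply, smul_eq_mul]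
  ring

theorem norm_sub_smul_add_sq_le {E : Type*} [NormedAddCommGroup E] [InnerProductSpace ℝ E]
    (d a ξ : E) (γ : ℝ) :
    ‖d - γ • (a + ξ)‖ ^ 2 ≤ ‖d‖ ^ 2 - 2 * γ * inner ℝ a d - 2 * γ * inner ℝ ξ d +
      2 * γ ^ 2 * (‖a‖ ^ 2 + ‖ξ‖ ^ 2) := by
  have h1 := norm_sub_sq_real d (γ • (a + ξ))
  have h2 : ‖a + ξ‖ ^ 2 ≤ 2 * (‖a‖ ^ 2 + ‖ξ‖ ^ 2) := by
    have h3 : ‖a + ξ‖ ^ 2 ≤ (‖a‖ + ‖ξ‖) ^ 2 := by gcongr; exact norm_add_le _ _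
    exact h3.trans (add_sq_le)
  rw [norm_smul, mul_pow, Real.norm_eq_abs, sq_abs, real_inner_smul_right, inner_add_right,
    real_inner_comm a d, real_inner_comm ξ d] at h1
  have h4 := mul_le_mul_of_nonneg_left h2 (sq_nonneg γ)
  linarith

section Step

variable {n m : ℕ} {X : Set (Vec n)} {f : Fin n → ℝ → ℝ} {g : Fin m → Vec n → ℝ}

/-- One step of the algorithm, as a function of the current iterates and the noises. -/
noncomputable def stepMap (X : Set (Vec n)) (f : Fin n → ℝ → ℝ) (g : Fin m → Vec n → ℝ)
    (γ α : ℝ) (z : Vec n × Vec m) (v : Vec m × (Fin n → Vec m)) : Vec n × Vec m :=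
  (proj X (z.1 - γ • (primalGrad f g z.1 z.2 + α • z.1 + gradNoise v.2 z.2)),
    cloudStep γ α z.2 (constraintVec g z.1 + v.1))

theorem iterates_succ (γ α : ℕ → ℝ) (x₀ : Vec n) (μ₀ : Vec m) (w : Fin n → ℕ → Vec m)
    (wg : ℕ → Vec m) (k : ℕ) :
    iterates X f g γ α x₀ μ₀ w wg (k + 1) =
      stepMap X f g (γ k) (α k) (iterates X f g γ α x₀ μ₀ w wg k) (wg k, fun i => w i k) := by
  rw [iterates, stepMap, toLp_agentStep]
  rfl

theorem continuous_stepMap (H : IsConvexProgram f g) (hX : IsCompact X) (hne : X.Nonempty)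
    (hconv : Convex ℝ X) (γ α : ℝ) :
    Continuous fun p : (Vec n × Vec m) × (Vec m × (Fin n → Vec m)) =>
      stepMap X f g γ α p.1 p.2 := by
  have h1 : Continuous fun p : (Vec n × Vec m) × (Vec m × (Fin n → Vec m)) =>
      primalGrad f g p.1.1 p.1.2 := (continuous_primalGrad H).comp continuous_fst
  have h2 : Continuous fun p : (Vec n × Vec m) × (Vec m × (Fin n → Vec m)) =>
      gradNoise p.2.2 p.1.2 := by
    unfold gradNoise
    fun_prop
  have h3 := H.continuous_constraintVec
  refine ((continuous_proj hX hne hconv).comp (by fun_prop)).prodMk ?_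
  exact (continuous_cloudStep γ α).comp
    (by fun_prop : Continuous fun p : (Vec n × Vec m) × (Vec m × (Fin n → Vec m)) =>
      (p.1.2, constraintVec g p.1.1 + p.2.1))

theorem measurable_iterates (H : IsConvexProgram f g) (hX : IsCompact X) (hne : X.Nonempty)
    (hconv : Convex ℝ X) (γ α : ℕ → ℝ) (x₀ : Vec n) (μ₀ : Vec m) (k : ℕ) :
    Measurable fun y : ℕ → Vec m × (Fin n → Vec m) =>
      iterates X f g γ α x₀ μ₀ (fun i t => (y t).2 i) (fun t => (y t).1) k := by
  induction k with
  | zero => exact measurable_const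
  | succ k ih =>
    have hs := (continuous_stepMap H hX hne hconv (γ k) (α k)).measurable.comp
      (ih.prodMk (measurable_pi_apply k))
    have heq : (fun y : ℕ → Vec m × (Fin n → Vec m) =>
        iterates X f g γ α x₀ μ₀ (fun i t => (y t).2 i) (fun t => (y t).1) (k + 1)) =
        (fun p : (Vec n × Vec m) × (Vec m × (Fin n → Vec m)) =>
          stepMap X f g (γ k) (α k) p.1 p.2) ∘ fun y =>
          (iterates X f g γ α x₀ μ₀ (fun i t => (y t).2 i) (fun t => (y t).1) k, y k) :=
      funext fun y => iterates_succ _ _ _ _ _ _ _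
    rw [heq]
    exact hs

theorem iterates_congr (γ α : ℕ → ℝ) (x₀ : Vec n) (μ₀ : Vec m)
    {y y' : ℕ → Vec m × (Fin n → Vec m)} {k : ℕ} (h : ∀ t < k, y t = y' t) :
    iterates X f g γ α x₀ μ₀ (fun i t => (y t).2 i) (fun t => (y t).1) k =
      iterates X f g γ α x₀ μ₀ (fun i t => (y' t).2 i) (fun t => (y' t).1) k := by
  induction k with
  | zero => rfl
  | succ k ih =>
    rw [iterates_succ, iterates_succ, ih fun t ht => h t (ht.trans k.lt_succ_self),
      h k k.lt_succ_self]

/-- The iterates at time `k` depend on the noises before time `k` only. -/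
theorem exists_measurable_iterates_eq (H : IsConvexProgram f g) (hX : IsCompact X)
    (hne : X.Nonempty) (hconv : Convex ℝ X) (γ α : ℕ → ℝ) (x₀ : Vec n) (μ₀ : Vec m) (k : ℕ) :
    ∃ Ψ : (Finset.range k → Vec m × (Fin n → Vec m)) → Vec n × Vec m, Measurable Ψ ∧
      ∀ y : ℕ → Vec m × (Fin n → Vec m),
        iterates X f g γ α x₀ μ₀ (fun i t => (y t).2 i) (fun t => (y t).1) k =
          Ψ fun t => y t := by
  refine ⟨fun y => iterates X f g γ α x₀ μ₀
    (fun i t => (if ht : t ∈ Finset.range k then y ⟨t, ht⟩ else 0).2 i)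
    (fun t => (if ht : t ∈ Finset.range k then y ⟨t, ht⟩ else 0).1) k, ?_, fun y => ?_⟩
  · refine (measurable_iterates H hX hne hconv γ α x₀ μ₀ k).comp
      (f := fun (y : Finset.range k → Vec m × (Fin n → Vec m)) t =>
        if ht : t ∈ Finset.range k then y ⟨t, ht⟩ else 0) (measurable_pi_lambda _ fun t => ?_)
    by_cases ht : t ∈ Finset.range k
    · simpa only [ht, dif_pos] using measurable_pi_apply (⟨t, ht⟩ : Finset.range k)
    · simp only [ht, dif_neg, not_false_eq_true]
      exact measurable_const
  · exact iterates_congr γ α x₀ μ₀ (y' := fun t => if ht : t ∈ Finset.range k then y t else 0)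
      fun t ht => by rw [dif_pos (Finset.mem_range.2 ht)]

/-- Both projections are nonexpansive and fix the regularized saddle point. Expanding the squares
leaves an inner product with the regularized operator, and strong monotonicity turns it into the
contraction `2γα`. -/
theorem norm_stepMap_sub_sq_le (H : IsConvexProgram f g) (hX : IsCompact X) (hconv : Convex ℝ X)
    {γ α : ℝ} (hγ : 0 ≤ γ) {y : Vec n} {ν : Vec m} (h : IsRegularizedSaddle X f g α y ν)
    {x : Vec n} (hx : x ∈ X) {μ : Vec m} (hμ : ∀ j, 0 ≤ μ j) (v : Vec m × (Fin n → Vec m)) :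
    ‖(stepMap X f g γ α (x, μ) v).1 - y‖ ^ 2 + ‖(stepMap X f g γ α (x, μ) v).2 - ν‖ ^ 2 ≤
      (1 - 2 * (γ * α)) * (‖x - y‖ ^ 2 + ‖μ - ν‖ ^ 2) +
      2 * γ ^ 2 * (‖primalGrad f g x μ + α • x‖ ^ 2 + ‖α • μ - constraintVec g x‖ ^ 2) +
      2 * γ ^ 2 * (‖gradNoise v.2 μ‖ ^ 2 + ‖v.1‖ ^ 2) +
      2 * γ * (inner ℝ v.1 (μ - ν) - inner ℝ (gradNoise v.2 μ) (x - y)) := by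
  have h1 : ‖(stepMap X f g γ α (x, μ) v).1 - y‖ ^ 2 ≤
      ‖(x - y) - γ • ((primalGrad f g x μ + α • x) + gradNoise v.2 μ)‖ ^ 2 := by
    refine pow_le_pow_left₀ (norm_nonneg _) ((norm_proj_sub_le hX ⟨x, hx⟩ hconv _
      h.primal_mem).trans_eq ?_) 2
    congr 1
    abel
  have h2 : ‖(stepMap X f g γ α (x, μ) v).2 - ν‖ ^ 2 ≤
      ‖(μ - ν) - γ • ((α • μ - constraintVec g x) + -v.1)‖ ^ 2 := by
    refine pow_le_pow_left₀ (norm_nonneg _) ((norm_cloudStep_sub_le γ α _ _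
      h.dual_nonneg).trans_eq ?_) 2
    congr 1
    simp only [smul_sub, smul_add, smul_neg]
    abel
  have h3 := norm_sub_smul_add_sq_le (x - y) (primalGrad f g x μ + α • x) (gradNoise v.2 μ) γ
  have h4 := norm_sub_smul_add_sq_le (μ - ν) (α • μ - constraintVec g x) (-v.1) γ
  have h5 := mul_le_mul_of_nonneg_left (h.strongly_monotone H hx hμ) (mul_nonneg zero_le_two hγ)
  rw [norm_neg, inner_neg_left] at h4
  linarith

theorem exists_norm_regularized_gradient_sq_le (H : IsConvexProgram f g) (hX : IsCompact X)
    (A : ℝ) : ∃ C, 0 ≤ C ∧ ∀ x ∈ X, ∀ (μ : Vec m) (α : ℝ), 0 ≤ α → α ≤ A →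
      ‖primalGrad f g x μ + α • x‖ ^ 2 + ‖α • μ - constraintVec g x‖ ^ 2 ≤
        C * (1 + ‖μ‖ ^ 2) := by
  obtain ⟨C₁, hC₁, h1⟩ := exists_norm_primalGrad_sq_le H hX
  obtain ⟨R, hR⟩ := hX.isBounded.exists_norm_le
  obtain ⟨M, hM⟩ := hX.exists_bound_of_continuousOn H.continuous_constraintVec.continuousOn
  refine ⟨2 * (C₁ + (A * R) ^ 2 + A ^ 2 + M ^ 2), by positivity, fun x hx μ α h0 hA => ?_⟩
  have hR' := hR x hx
  have hM' := hM x hx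
  have h2 := h1 x hx μ
  have hA0 : 0 ≤ A := h0.trans hA
  have h3 : ‖α • x‖ ^ 2 ≤ (A * R) ^ 2 := by
    rw [norm_smul, Real.norm_of_nonneg h0]
    gcongr
  have h4 : ‖α • μ‖ ^ 2 ≤ A ^ 2 * ‖μ‖ ^ 2 := by
    rw [norm_smul, Real.norm_of_nonneg h0, mul_pow]
    gcongr
  have h5 : ‖constraintVec g x‖ ^ 2 ≤ M ^ 2 := by gcongr
  have h6 : ‖primalGrad f g x μ + α • x‖ ^ 2 ≤ 2 * (‖primalGrad f g x μ‖ ^ 2 + ‖α • x‖ ^ 2) :=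
    (pow_le_pow_left₀ (norm_nonneg _) (norm_add_le _ _) 2).trans add_sq_le
  have h7 : ‖α • μ - constraintVec g x‖ ^ 2 ≤ 2 * (‖α • μ‖ ^ 2 + ‖constraintVec g x‖ ^ 2) :=
    (pow_le_pow_left₀ (norm_nonneg _) (norm_sub_le _ _) 2).trans add_sq_le
  have h8 : 0 ≤ ((A * R) ^ 2 + M ^ 2) * ‖μ‖ ^ 2 := by positivity
  have h9 : 0 ≤ A ^ 2 := sq_nonneg A
  linarith

end Step

/-! ### The algorithm in mean square -/

section Expectation

variable {n m : ℕ} {X : Set (Vec n)} {f : Fin n → ℝ → ℝ} {g : Fin m → Vec n → ℝ}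
  {Ω : Type*} [MeasurableSpace Ω] {P : Measure Ω}

/-- A centered Gaussian vector with independent coordinates of standard deviation at most `s`. -/
def IsGaussianNoise {m : ℕ} (P : Measure Ω) (s : ℝ) (W : Ω → Vec m) : Prop :=
  ∃ r, 0 ≤ r ∧ r ≤ s ∧ HasLaw W (multivariateGaussian 0 (r ^ 2 • 1)) P

theorem IsGaussianNoise.memLp {s : ℝ} {W : Ω → Vec m} (h : IsGaussianNoise P s W) :
    MemLp W 2 P := by
  obtain ⟨r, -, -, h⟩ := h
  exact memLp_two_of_hasLaw_gaussian h

theorem IsGaussianNoise.integral_apply {s : ℝ} {W : Ω → Vec m} (h : IsGaussianNoise P s W)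
    (j : Fin m) : ∫ ω, W ω j ∂P = 0 := by
  obtain ⟨r, -, -, h⟩ := h
  exact integral_apply_of_hasLaw_gaussian h j

theorem IsGaussianNoise.integral_norm_sq_le [IsProbabilityMeasure P] {s : ℝ} {W : Ω → Vec m} (h : IsGaussianNoise P s W) :
    ∫ ω, ‖W ω‖ ^ 2 ∂P ≤ m * s ^ 2 := by
  obtain ⟨r, h0, h1, h⟩ := h
  rw [integral_norm_sq_of_hasLaw_gaussian h]
  gcongr

/-- A run of the algorithm with Gaussian noises that are independent at different times. -/
structure IsNoisyRun (X : Set (Vec n)) (f : Fin n → ℝ → ℝ) (g : Fin m → Vec n → ℝ)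
    (γ α : ℕ → ℝ) (x₀ : Vec n) (μ₀ : Vec m) (s : ℝ) (P : Measure Ω) (w : Fin n → ℕ → Ω → Vec m)
    (wg : ℕ → Ω → Vec m) (x : ℕ → Ω → Vec n) (μ : ℕ → Ω → Vec m) : Prop where
  start_mem : x₀ ∈ X
  noise_partial : ∀ i k, IsGaussianNoise P s (w i k)
  noise_constraint : ∀ k, IsGaussianNoise P s (wg k)
  indep : iIndepFun (fun k ω => (wg k ω, fun i => w i k ω)) P
  iter : ∀ k ω, (x k ω, μ k ω) =
      iterates X f g γ α x₀ μ₀ (fun i t => w i t ω) (fun t => wg t ω) k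

namespace IsNoisyRun

variable {γ α : ℕ → ℝ} {x₀ : Vec n} {μ₀ : Vec m} {s : ℝ} {w : Fin n → ℕ → Ω → Vec m}
    {wg : ℕ → Ω → Vec m} {x : ℕ → Ω → Vec n} {μ : ℕ → Ω → Vec m}

theorem aemeasurable_noise (h : IsNoisyRun X f g γ α x₀ μ₀ s P w wg x μ) (k : ℕ) :
    AEMeasurable (fun ω => (wg k ω, fun i => w i k ω)) P :=
  (h.noise_constraint k).memLp.aestronglyMeasurable.aemeasurable.prodMk
    (aemeasurable_pi_lambda _ fun i =>
      (h.noise_partial i k).memLp.aestronglyMeasurable.aemeasurable)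

theorem step (h : IsNoisyRun X f g γ α x₀ μ₀ s P w wg x μ) (k : ℕ) (ω : Ω) :
    (x (k + 1) ω, μ (k + 1) ω) =
      stepMap X f g (γ k) (α k) (x k ω, μ k ω) (wg k ω, fun i => w i k ω) := by
  rw [h.iter, iterates_succ, h.iter k ω]

theorem primal_mem (h : IsNoisyRun X f g γ α x₀ μ₀ s P w wg x μ) (hX : IsCompact X) (k : ℕ)
    (ω : Ω) : x k ω ∈ X := by
  cases k with
  | zero => rw [show x 0 ω = _ from congrArg Prod.fst (h.iter 0 ω)]; exact h.start_mem
  | succ k =>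
    rw [show x (k + 1) ω = _ from congrArg Prod.fst (h.step k ω)]
    exact proj_mem hX ⟨x₀, h.start_mem⟩ _

theorem dual_nonneg (h : IsNoisyRun X f g γ α x₀ μ₀ s P w wg x μ) {k : ℕ} (hk : k ≠ 0)
    (ω : Ω) (j : Fin m) : 0 ≤ μ k ω j := by
  obtain ⟨k, rfl⟩ := Nat.exists_eq_succ_of_ne_zero hk
  rw [show μ (k + 1) ω = _ from congrArg Prod.snd (h.step k ω)]
  exact le_max_right _ _

theorem aemeasurable (h : IsNoisyRun X f g γ α x₀ μ₀ s P w wg x μ) (H : IsConvexProgram f g)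
    (hX : IsCompact X) (hconv : Convex ℝ X) (k : ℕ) :
    AEMeasurable (fun ω => (x k ω, μ k ω)) P := by
  obtain ⟨Ψ, hΨ, heq⟩ :=
    exists_measurable_iterates_eq H hX ⟨x₀, h.start_mem⟩ hconv γ α x₀ μ₀ k
  have : (fun ω => (x k ω, μ k ω)) = fun ω =>
      Ψ fun t : Finset.range k => (wg t ω, fun i => w i t ω) := funext fun ω =>
    (h.iter k ω).trans (heq fun t => (wg t ω, fun i => w i t ω))
  rw [this]
  exact hΨ.comp_aemeasurable (aemeasurable_pi_lambda _ fun t => h.aemeasurable_noise t)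

theorem indepFun (h : IsNoisyRun X f g γ α x₀ μ₀ s P w wg x μ) (H : IsConvexProgram f g)
    (hX : IsCompact X) (hconv : Convex ℝ X) (k : ℕ) :
    IndepFun (fun ω => (x k ω, μ k ω)) (fun ω => (wg k ω, fun i => w i k ω)) P := by
  obtain ⟨Ψ, hΨ, heq⟩ :=
    exists_measurable_iterates_eq H hX ⟨x₀, h.start_mem⟩ hconv γ α x₀ μ₀ k
  have : (fun ω => (x k ω, μ k ω)) = fun ω =>
      Ψ fun t : Finset.range k => (wg t ω, fun i => w i t ω) := funext fun ω =>
    (h.iter k ω).trans (heq fun t => (wg t ω, fun i => w i t ω))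
  rw [this]
  have hi := h.indep.indepFun_finset₀ (Finset.range k) {k} (by simp) h.aemeasurable_noise
  exact hi.comp (φ := Ψ) (ψ := fun y : ({k} : Finset ℕ) → Vec m × (Fin n → Vec m) =>
    y ⟨k, Finset.mem_singleton_self k⟩) hΨ (measurable_pi_apply _)

end IsNoisyRun

variable [IsProbabilityMeasure P]

/-- In expectation the terms linear in the noise vanish. The quadratic terms are `O(γ² (1 +
E‖μ‖²))`, and `‖ν‖ ≤ R` converts this into the mean-square distance to `(y, ν)`. Each noise term
involves a single noise vector, so the noises of one time step may depend on each other. -/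
theorem integral_norm_stepMap_sub_sq_le (H : IsConvexProgram f g) (hX : IsCompact X)
    (hconv : Convex ℝ X) {γ α C s R : ℝ} (hγ : 0 ≤ γ) (hC : 0 ≤ C) {y : Vec n} {ν : Vec m}
    (h : IsRegularizedSaddle X f g α y ν) (hν : ‖ν‖ ≤ R)
    (hgrow : ∀ x ∈ X, ∀ μ : Vec m, ‖primalGrad f g x μ + α • x‖ ^ 2 +
      ‖α • μ - constraintVec g x‖ ^ 2 ≤ C * (1 + ‖μ‖ ^ 2))
    {x : Ω → Vec n} {μ : Ω → Vec m} (hxX : ∀ ω, x ω ∈ X) (hμ0 : ∀ ω j, 0 ≤ μ ω j)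
    (hx : MemLp x 2 P) (hμ : MemLp μ 2 P) {v : Ω → Vec m} {w : Fin n → Ω → Vec m}
    (hv : IsGaussianNoise P s v) (hw : ∀ i, IsGaussianNoise P s (w i))
    (hind : IndepFun (fun ω => (x ω, μ ω)) (fun ω => (v ω, fun i => w i ω)) P)
    {x' : Ω → Vec n} {μ' : Ω → Vec m}
    (hstep : ∀ ω, (x' ω, μ' ω) = stepMap X f g γ α (x ω, μ ω) (v ω, fun i => w i ω))
    (hx' : MemLp x' 2 P) (hμ' : MemLp μ' 2 P) :
    ∫ ω, (‖x' ω - y‖ ^ 2 + ‖μ' ω - ν‖ ^ 2) ∂P ≤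
      (1 - 2 * (γ * α) + 2 * (C + (n + 1) * (m * s ^ 2)) * (2 + 2 * R ^ 2) * γ ^ 2) *
        ∫ ω, (‖x ω - y‖ ^ 2 + ‖μ ω - ν‖ ^ 2) ∂P +
      2 * (C + (n + 1) * (m * s ^ 2)) * (2 + 2 * R ^ 2) * γ ^ 2 := by
  have hindw : ∀ i, IndepFun μ (w i) P := fun i =>
    hind.comp (φ := Prod.snd) (ψ := fun p : Vec m × (Fin n → Vec m) => p.2 i) (by fun_prop)
      (by fun_prop)
  have hindv : IndepFun (fun ω => μ ω - ν) v P :=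
    hind.comp (φ := fun p : Vec n × Vec m => p.2 - ν) (ψ := Prod.fst) (by fun_prop) (by fun_prop)
  -- The cross term `⟨gradNoise, x - y⟩` is the sum of the `⟨wᵢ, (x - y)ᵢ μ⟩`, which separates each
  -- noise from the iterates.
  have hindxw : ∀ i, IndepFun (fun ω => (x ω - y) i • μ ω) (w i) P := fun i =>
    hind.comp (φ := fun p : Vec n × Vec m => (p.1 - y) i • p.2)
      (ψ := fun p : Vec m × (Fin n → Vec m) => p.2 i) (by fun_prop) (by fun_prop)
  have hxy : MemLp (fun ω => x ω - y) 2 P := hx.sub (memLp_const y)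
  have hμν : MemLp (fun ω => μ ω - ν) 2 P := hμ.sub (memLp_const ν)
  have hxμ : ∀ i, Integrable (fun ω => (x ω - y) i • μ ω) P := fun i =>
    memLp_one_iff_integrable.1 (hμ.smul (hxy.eval_piLp i))
  have hI1 : Integrable (fun ω => ‖x ω - y‖ ^ 2 + ‖μ ω - ν‖ ^ 2) P :=
    hxy.norm.integrable_sq.add hμν.norm.integrable_sq
  have hI2 : Integrable (fun ω => ‖μ ω‖ ^ 2) P := hμ.norm.integrable_sq
  have hnoise : ∀ ω, ‖gradNoise (fun i => w i ω) (μ ω)‖ ^ 2 = ∑ i, inner ℝ (w i ω) (μ ω) ^ 2 :=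
    fun ω => by simp [EuclideanSpace.real_norm_sq_eq, gradNoise]
  have hcross : ∀ ω, inner ℝ (gradNoise (fun i => w i ω) (μ ω)) (x ω - y) =
      ∑ i, inner ℝ (w i ω) ((x ω - y) i • μ ω) := fun ω => by
    rw [PiLp.inner_apply]
    simp [gradNoise, real_inner_smul_right]
  have hI3 : ∀ i, Integrable (fun ω => inner ℝ (w i ω) (μ ω) ^ 2) P := fun i =>
    (integrable_inner_sq_and_integral_le (hindw i) hμ (hw i).memLp).1
  have hI3' : Integrable (fun ω => ∑ i, inner ℝ (w i ω) (μ ω) ^ 2) P :=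
    integrable_finsetSum _ fun i _ => hI3 i
  have hI4 : Integrable (fun ω => ‖v ω‖ ^ 2) P := hv.memLp.norm.integrable_sq
  have hI5 : Integrable (fun ω => inner ℝ (v ω) (μ ω - ν)) P :=
    integrable_inner_of_indepFun hindv (hμν.integrable one_le_two)
      (hv.memLp.integrable one_le_two)
  have hI6 : ∀ i, Integrable (fun ω => inner ℝ (w i ω) ((x ω - y) i • μ ω)) P := fun i =>
    integrable_inner_of_indepFun (hindxw i) (hxμ i) ((hw i).memLp.integrable one_le_two)
  have hI6' : Integrable (fun ω => ∑ i, inner ℝ (w i ω) ((x ω - y) i • μ ω)) P :=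
    integrable_finsetSum _ fun i _ => hI6 i
  have hpoint : ∀ ω, ‖x' ω - y‖ ^ 2 + ‖μ' ω - ν‖ ^ 2 ≤
      (1 - 2 * (γ * α)) * (‖x ω - y‖ ^ 2 + ‖μ ω - ν‖ ^ 2) +
      2 * γ ^ 2 * (C * (1 + ‖μ ω‖ ^ 2)) +
      2 * γ ^ 2 * ((∑ i, inner ℝ (w i ω) (μ ω) ^ 2) + ‖v ω‖ ^ 2) +
      2 * γ * (inner ℝ (v ω) (μ ω - ν) - ∑ i, inner ℝ (w i ω) ((x ω - y) i • μ ω)) := fun ω => by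
    have h1 := norm_stepMap_sub_sq_le H hX hconv hγ h (hxX ω) (hμ0 ω) (v ω, fun i => w i ω)
    rw [← hstep ω] at h1
    simp only [hnoise, hcross] at h1
    have h2 := mul_le_mul_of_nonneg_left (hgrow (x ω) (hxX ω) (μ ω))
      (by positivity : 0 ≤ 2 * γ ^ 2)
    linarith
  have hE3 : ∫ ω, ∑ i, inner ℝ (w i ω) (μ ω) ^ 2 ∂P ≤ n * (m * s ^ 2) * ∫ ω, ‖μ ω‖ ^ 2 ∂P := by
    rw [integral_finsetSum _ fun i _ => hI3 i]
    have h0 : 0 ≤ ∫ ω, ‖μ ω‖ ^ 2 ∂P := integral_nonneg fun ω => sq_nonneg _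
    calc ∑ i, ∫ ω, inner ℝ (w i ω) (μ ω) ^ 2 ∂P
        ≤ ∑ _i : Fin n, (m * s ^ 2) * ∫ ω, ‖μ ω‖ ^ 2 ∂P := Finset.sum_le_sum fun i _ =>
          (integrable_inner_sq_and_integral_le (hindw i) hμ (hw i).memLp).2.trans
            (mul_le_mul_of_nonneg_right (hw i).integral_norm_sq_le h0)
      _ = _ := by simp [mul_assoc]
  have hE5 : ∫ ω, inner ℝ (v ω) (μ ω - ν) ∂P = 0 :=
    integral_inner_eq_zero_of_indepFun hindv (hμν.integrable one_le_two)
      (hv.memLp.integrable one_le_two) hv.integral_apply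
  have hE6 : ∫ ω, ∑ i, inner ℝ (w i ω) ((x ω - y) i • μ ω) ∂P = 0 := by
    rw [integral_finsetSum _ fun i _ => hI6 i]
    exact Finset.sum_eq_zero fun i _ => integral_inner_eq_zero_of_indepFun (hindxw i) (hxμ i)
      ((hw i).memLp.integrable one_le_two) (hw i).integral_apply
  have hE2 : ∫ ω, ‖μ ω‖ ^ 2 ∂P ≤
      2 * ∫ ω, (‖x ω - y‖ ^ 2 + ‖μ ω - ν‖ ^ 2) ∂P + 2 * R ^ 2 := by
    have h1 : ∀ ω, ‖μ ω‖ ^ 2 ≤ 2 * (‖x ω - y‖ ^ 2 + ‖μ ω - ν‖ ^ 2) + 2 * R ^ 2 := fun ω => by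
      have h2 : ‖μ ω‖ ≤ ‖μ ω - ν‖ + ‖ν‖ := by simpa using norm_add_le (μ ω - ν) ν
      have h3 : ‖μ ω‖ ^ 2 ≤ 2 * (‖μ ω - ν‖ ^ 2 + ‖ν‖ ^ 2) :=
        (pow_le_pow_left₀ (norm_nonneg _) h2 2).trans add_sq_le
      have h4 : ‖ν‖ ^ 2 ≤ R ^ 2 := by gcongr
      nlinarith [sq_nonneg ‖x ω - y‖]
    refine (integral_mono hI2 ((hI1.const_mul 2).add (integrable_const _)) h1).trans_eq ?_
    simp only [Pi.add_apply]
    rw [integral_add (hI1.const_mul 2) (integrable_const _), integral_const_mul]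
    simp
  have hJ1 := hI1.const_mul (1 - 2 * (γ * α))
  have hJ2 : Integrable (fun ω => 2 * γ ^ 2 * (C * (1 + ‖μ ω‖ ^ 2))) P :=
    (((integrable_const (1 : ℝ)).add hI2).const_mul C).const_mul (2 * γ ^ 2)
  have hJ3 : Integrable (fun ω => 2 * γ ^ 2 * ((∑ i, inner ℝ (w i ω) (μ ω) ^ 2) + ‖v ω‖ ^ 2)) P :=
    (hI3'.add hI4).const_mul (2 * γ ^ 2)
  have hJ4 : Integrable (fun ω => 2 * γ * (inner ℝ (v ω) (μ ω - ν) -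
      ∑ i, inner ℝ (w i ω) ((x ω - y) i • μ ω))) P := (hI5.sub hI6').const_mul (2 * γ)
  have hint := integral_mono
    ((hx'.sub (memLp_const y)).norm.integrable_sq.add (hμ'.sub (memLp_const ν)).norm.integrable_sq)
    (((hJ1.add hJ2).add hJ3).add hJ4) hpoint
  refine hint.trans ?_
  rw [integral_add' ((hJ1.add hJ2).add hJ3) hJ4, integral_add' (hJ1.add hJ2) hJ3,
    integral_add' hJ1 hJ2, integral_const_mul, integral_const_mul, integral_const_mul,
    integral_const_mul, integral_const_mul, integral_add (integrable_const _) hI2,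
    integral_add hI3' hI4, integral_sub hI5 hI6', hE5, hE6]
  have hE4 := hv.integral_norm_sq_le
  simp only [integral_const, probReal_univ, smul_eq_mul, mul_one, sub_zero, mul_zero, add_zero]
  set e := ∫ ω, (‖x ω - y‖ ^ 2 + ‖μ ω - ν‖ ^ 2) ∂P
  set Eμ := ∫ ω, ‖μ ω‖ ^ 2 ∂P
  have he : 0 ≤ e := integral_nonneg fun ω => by positivity
  have hEμ : 0 ≤ Eμ := integral_nonneg fun ω => sq_nonneg _
  have hK : 0 ≤ (m : ℝ) * s ^ 2 := by positivity
  have h1 : (∫ ω, ∑ i, inner ℝ (w i ω) (μ ω) ^ 2 ∂P) + ∫ ω, ‖v ω‖ ^ 2 ∂P ≤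
      (n + 1) * (m * s ^ 2) * (1 + Eμ) := by
    have : 0 ≤ (n : ℝ) * (m * s ^ 2) + (m * s ^ 2) * Eμ := by positivity
    linarith
  have h2 : 1 + Eμ ≤ (2 + 2 * R ^ 2) * (1 + e) := by nlinarith [sq_nonneg R]
  have h3 : C * (1 + Eμ) + (n + 1) * (m * s ^ 2) * (1 + Eμ) ≤
      (C + (n + 1) * (m * s ^ 2)) * ((2 + 2 * R ^ 2) * (1 + e)) := by
    rw [← add_mul]
    gcongr
  have h4 := mul_le_mul_of_nonneg_left ((add_le_add_right h1 (C * (1 + Eμ))).trans h3)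
    (by positivity : 0 ≤ 2 * γ ^ 2)
  linarith

theorem norm_cloudStep_le {m : ℕ} (γ α : ℝ) (μ G : Vec m) :
    ‖cloudStep γ α μ G‖ ≤ ‖μ + γ • (G - α • μ)‖ := by
  simpa using norm_cloudStep_sub_le γ α μ G (ν := 0) fun j => by simp

namespace IsNoisyRun

variable {γ α : ℕ → ℝ} {x₀ : Vec n} {μ₀ : Vec m} {s : ℝ} {w : Fin n → ℕ → Ω → Vec m}
    {wg : ℕ → Ω → Vec m} {x : ℕ → Ω → Vec n} {μ : ℕ → Ω → Vec m}

/-- The primal iterates are bounded. A dual iterate is dominated by an affine expression in the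
previous one, bounded constraint values and Gaussian noise. -/
theorem memLp (h : IsNoisyRun X f g γ α x₀ μ₀ s P w wg x μ) (H : IsConvexProgram f g)
    (hX : IsCompact X) (hconv : Convex ℝ X) (k : ℕ) : MemLp (x k) 2 P ∧ MemLp (μ k) 2 P := by
  have hm := h.aemeasurable H hX hconv
  have hx : ∀ k, MemLp (x k) 2 P := fun k => by
    obtain ⟨R, hR⟩ := hX.isBounded.exists_norm_le
    exact MemLp.of_bound (hm k).fst.aestronglyMeasurable R
      (ae_of_all _ fun ω => hR _ (h.primal_mem hX k ω))
  refine ⟨hx k, ?_⟩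
  induction k with
  | zero =>
    have : μ 0 = fun _ => μ₀ := funext fun ω => (Prod.ext_iff.1 (h.iter 0 ω)).2
    rw [this]
    exact memLp_const μ₀
  | succ k ih =>
    obtain ⟨M, hM⟩ := hX.exists_bound_of_continuousOn H.continuous_constraintVec.continuousOn
    have hg : MemLp (fun ω => constraintVec g (x k ω)) 2 P :=
      MemLp.of_bound (H.continuous_constraintVec.measurable.comp_aemeasurable
        (hm k).fst).aestronglyMeasurable M (ae_of_all _ fun ω => hM _ (h.primal_mem hX k ω))
    have hb : MemLp (fun ω => μ k ω + γ k • ((constraintVec g (x k ω) + wg k ω) - α k • μ k ω))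
        2 P :=
      ih.add (((hg.add (h.noise_constraint k).memLp).sub (ih.const_smul (α k))).const_smul (γ k))
    refine hb.mono (hm (k + 1)).snd.aestronglyMeasurable (ae_of_all _ fun ω => ?_)
    rw [show μ (k + 1) ω = _ from congrArg Prod.snd (h.step k ω)]
    exact norm_cloudStep_le _ _ _ _

end IsNoisyRun

/-- Young's inequality with weight `ρ`. For `ρ = γα`, moving to the next regularized saddle point
costs only part of the contraction `1 - 2γα`. -/
theorem norm_sub_sq_le_add {E : Type*} [SeminormedAddCommGroup E] {ρ : ℝ} (hρ : 0 < ρ)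
    (z y y' : E) : ‖z - y'‖ ^ 2 ≤ (1 + ρ) * ‖z - y‖ ^ 2 + (1 + 1 / ρ) * ‖y - y'‖ ^ 2 := by
  have h1 : ‖z - y'‖ ≤ ‖z - y‖ + ‖y - y'‖ := norm_sub_le_norm_sub_add_norm_sub _ _ _
  have h2 : ‖z - y'‖ ^ 2 ≤ (‖z - y‖ + ‖y - y'‖) ^ 2 := by gcongr
  set p := ‖z - y‖
  set q := ‖y - y'‖
  have h3 : 2 * p * q ≤ ρ * p ^ 2 + 1 / ρ * q ^ 2 := by
    have h4 : 0 ≤ (ρ * p - q) ^ 2 / ρ := by positivity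
    have h5 : (ρ * p - q) ^ 2 / ρ = ρ * p ^ 2 + 1 / ρ * q ^ 2 - 2 * p * q := by
      field_simp
      ring
    linarith
  nlinarith

theorem integral_norm_sub_sq_add_le {x : Ω → Vec n} {μ : Ω → Vec m} (hx : MemLp x 2 P)
    (hμ : MemLp μ 2 P) {ρ : ℝ} (hρ : 0 < ρ) (y y' : Vec n) (ν ν' : Vec m) :
    ∫ ω, (‖x ω - y'‖ ^ 2 + ‖μ ω - ν'‖ ^ 2) ∂P ≤
      (1 + ρ) * ∫ ω, (‖x ω - y‖ ^ 2 + ‖μ ω - ν‖ ^ 2) ∂P +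
        (1 + 1 / ρ) * (‖y - y'‖ ^ 2 + ‖ν - ν'‖ ^ 2) := by
  have hI : ∀ (y : Vec n) (ν : Vec m), Integrable (fun ω => ‖x ω - y‖ ^ 2 + ‖μ ω - ν‖ ^ 2) P :=
    fun y ν => (hx.sub (memLp_const y)).norm.integrable_sq.add
      (hμ.sub (memLp_const ν)).norm.integrable_sq
  refine (integral_mono (hI y' ν') (((hI y ν).const_mul (1 + ρ)).add (integrable_const
    ((1 + 1 / ρ) * (‖y - y'‖ ^ 2 + ‖ν - ν'‖ ^ 2)))) fun ω => ?_).trans_eq ?_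
  · have h1 := norm_sub_sq_le_add hρ (x ω) y y'
    have h2 := norm_sub_sq_le_add hρ (μ ω) ν ν'
    simp only [Pi.add_apply]
    linarith
  · simp only [Pi.add_apply]
    rw [integral_add ((hI y ν).const_mul _) (integrable_const _), integral_const_mul]
    simp

theorem IsNoisyRun.tendsto_integral {γ₀ α₀ γbar αbar c₁ c₂ : ℝ} {x₀ : Vec n} {μ₀ : Vec m} {s : ℝ}
    {w : Fin n → ℕ → Ω → Vec m} {wg : ℕ → Ω → Vec m} {x : ℕ → Ω → Vec n} {μ : ℕ → Ω → Vec m}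
    (h : IsNoisyRun X f g (powerSeq γ₀ γbar c₁) (powerSeq α₀ αbar c₂) x₀ μ₀ s P w wg x μ)
    (H : IsConvexProgram f g) (hX : IsCompact X) (hconv : Convex ℝ X)
    (slater : ∃ xbar ∈ X, ∀ j, g j xbar < 0) (hγ : 0 < γbar) (hα : 0 < αbar) (hc₂ : 0 < c₂)
    (hc : c₂ < c₁) (hc₁ : c₁ + c₂ < 1) {xhat : Vec n} {μhat : Vec m}
    (huniq : ∀ x' μ', IsSaddlePoint X f g x' μ' → x' = xhat ∧ μ' = μhat) :
    Tendsto (fun k => ∫ ω, (‖x k ω - xhat‖ ^ 2 + ‖μ k ω - μhat‖ ^ 2) ∂P) atTop (𝓝 0) := by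
  set γ := powerSeq γ₀ γbar c₁
  set α := powerSeq α₀ αbar c₂ with hα_def
  have hγ0 : ∀ k, k ≠ 0 → 0 < γ k := fun k hk => powerSeq_pos hγ hk
  have hα0 : ∀ k, k ≠ 0 → 0 < α k := fun k hk => powerSeq_pos hα hk
  have hαlim : Tendsto α atTop (𝓝 0) := tendsto_powerSeq hc₂
  obtain ⟨A, hA⟩ := hαlim.bddAbove_range
  replace hA : ∀ k, α k ≤ A := fun k => hA ⟨k, rfl⟩
  have hsaddle : ∀ k, ∃ p : Vec n × Vec m, k ≠ 0 → IsRegularizedSaddle X f g (α k) p.1 p.2 :=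
    fun k => by
      by_cases hk : k = 0
      · exact ⟨0, fun h0 => absurd hk h0⟩
      · obtain ⟨p, hp⟩ := exists_isRegularizedSaddle H hX hconv ⟨x₀, h.start_mem⟩ (hα0 k hk)
        exact ⟨p, fun _ => hp⟩
  choose p hp using hsaddle
  obtain ⟨R, hR⟩ := exists_norm_le_of_isRegularizedSaddle H hX slater A
  obtain ⟨C, hC, hgrow⟩ := exists_norm_regularized_gradient_sq_le (m := m) H hX A
  have hlim : Tendsto p atTop (𝓝 (xhat, μhat)) := by
    rw [← tendsto_add_atTop_iff_nat 1]
    exact tendsto_regularizedSaddle H hX slater (fun k => (hα0 _ k.succ_ne_zero).le)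
      (hαlim.comp (tendsto_add_atTop_nat 1)) (fun k => hp _ k.succ_ne_zero) huniq
  set e : ℕ → ℝ := fun k => ∫ ω, (‖x k ω - (p k).1‖ ^ 2 + ‖μ k ω - (p k).2‖ ^ 2) ∂P with he_def
  have hmem := h.memLp H hX hconv
  have he : Tendsto e atTop (𝓝 0) := by
    refine tendsto_zero_of_powerSeq_recursion (γ₀ := γ₀) (α₀ := α₀) hγ hα hc₂ hc hc₁
      (fun k => integral_nonneg fun ω => by positivity)
      (C := 2 * (C + (n + 1) * (m * s ^ 2)) * (2 + 2 * R ^ 2)) (D := 2 * R ^ 2) (by positivity)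
      (by positivity) fun k hk => ?_
    have hpk := hp k hk
    have hρ : 0 < γ k * α k := mul_pos (hγ0 k hk) (hα0 k hk)
    have h1 := integral_norm_stepMap_sub_sq_le H hX hconv (hγ0 k hk).le hC hpk
      (hR _ _ _ (hα0 k hk).le (hA k) hpk).2
      (fun x hx μ => hgrow x hx μ _ (hα0 k hk).le (hA k)) (h.primal_mem hX k) (h.dual_nonneg hk)
      (hmem k).1 (hmem k).2 (h.noise_constraint k) (fun i => h.noise_partial i k)
      (h.indepFun H hX hconv k) (h.step k) (hmem (k + 1)).1 (hmem (k + 1)).2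
    have h2 := integral_norm_sub_sq_add_le (hmem (k + 1)).1 (hmem (k + 1)).2 hρ (p k).1
      (p (k + 1)).1 (p k).2 (p (k + 1)).2
    have hpk1 := hp (k + 1) k.succ_ne_zero
    have hRk := hR _ _ _ (hα0 _ k.succ_ne_zero).le (hA (k + 1)) hpk1
    have hR0 : 0 ≤ R := (norm_nonneg _).trans hRk.1
    have h3 := IsRegularizedSaddle.norm_sub_sq_le H (hα0 k hk) hpk hpk1 hRk.1 hRk.2
    have h4 : |α k - α (k + 1)| / α k ≤ 1 / k :=
      abs_powerSeq_sub_div_le hα hc₂.le (by linarith) hk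
    have h5 : ‖(p k).1 - (p (k + 1)).1‖ ^ 2 + ‖(p k).2 - (p (k + 1)).2‖ ^ 2 ≤
        2 * R ^ 2 * (1 / k) ^ 2 := by
      rw [norm_sub_rev (p k).1, norm_sub_rev (p k).2]
      refine h3.trans ?_
      rw [mul_pow, ← mul_assoc]
      have : 0 ≤ |α k - α (k + 1)| / α k := div_nonneg (abs_nonneg _) (hα0 k hk).le
      gcongr
    refine h2.trans (add_le_add ?_ ?_)
    · exact mul_le_mul_of_nonneg_left h1 (by positivity)
    · exact mul_le_mul_of_nonneg_left h5 (by positivity)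
  have hdist : Tendsto (fun k => ‖(p k).1 - xhat‖ ^ 2 + ‖(p k).2 - μhat‖ ^ 2) atTop (𝓝 0) := by
    have hcont : Continuous fun q : Vec n × Vec m => ‖q.1 - xhat‖ ^ 2 + ‖q.2 - μhat‖ ^ 2 := by
      fun_prop
    simpa [Function.comp_def] using (hcont.tendsto (xhat, μhat)).comp hlim
  have hub : Tendsto (fun k => (1 + 1) * e k +
      (1 + 1 / 1) * (‖(p k).1 - xhat‖ ^ 2 + ‖(p k).2 - μhat‖ ^ 2)) atTop (𝓝 0) := by
    simpa only [mul_zero, add_zero] using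
      (he.const_mul (1 + 1)).add (hdist.const_mul (1 + 1 / 1))
  exact squeeze_zero (fun k => integral_nonneg fun ω => by positivity)
    (fun k => integral_norm_sub_sq_add_le (hmem k).1 (hmem k).2 one_pos _ _ _ _) hub

end Expectation

end PrivOpt


theorem mainTheorem3 {n m : ℕ} [NeZero n]
    -- the constrained problem
    (X : Set (Vec n)) (f : Fin n → ℝ → ℝ) (g : Fin m → Vec n → ℝ)
    (hX_compact : IsCompact X) (hX_convex : Convex ℝ X)
    (hf_convex : ∀ i, ConvexOn ℝ Set.univ (f i)) (hf_smooth : ∀ i, ContDiff ℝ 2 (f i))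
    (hg_convex : ∀ j, ConvexOn ℝ Set.univ (g j)) (hg_smooth : ∀ j, ContDiff ℝ 2 (g j))
    (slater : ∃ xbar ∈ X, ∀ j, g j xbar < 0)
    -- the constrained minimum, and what makes the saddle point unique
    (xhat : Vec n) (hmin : IsUniqueConstrainedMin X f g xhat)
    (hreg : (xhat ∈ interior X ∧ IsRegularPoint g xhat) ∨
      ∀ x μ x' μ', IsSaddlePoint X f g x μ → IsSaddlePoint X f g x' μ' → x = x' ∧ μ = μ')
    -- step sizes and starting point
    (γ₀ α₀ γbar αbar c₁ c₂ : ℝ) (hγ : 0 < γbar) (hα : 0 < αbar)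
    (hc₂ : 0 < c₂) (hc : c₂ < c₁) (hc₁ : c₁ + c₂ < 1)
    (x₀ : Vec n) (hx₀ : x₀ ∈ X) (μ₀ : Vec m)
    -- privacy parameters and Lipschitz constants
    (ε δ : ℝ) (hε : 0 < ε) (hδ₀ : 0 < δ) (hδ₁ : δ < 1) (b : Fin n → ℝ) (hb : ∀ i, 0 ≤ b i)
    (B : ℝ) (hB : B = Finset.univ.sup' Finset.univ_nonempty b)
    (K : Fin n → ℝ≥0) (hK : ∀ i, LipschitzOnWith (K i) (constraintPartial g i) X)
    (Kg : ℝ≥0) (hKg : LipschitzOnWith Kg (constraintVec g) X)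
    -- standard deviations of the noises, bounded below and above
    (σ : Fin n → ℕ → ℝ) (σg : ℕ → ℝ)
    (hσ : ∀ i k, kappa δ ε * K i * B ≤ σ i k) (hσg : ∀ k, kappa δ ε * Kg * B ≤ σg k)
    (σmax : ℝ) (hσ_le : ∀ i k, σ i k ≤ σmax) (hσg_le : ∀ k, σg k ≤ σmax)
    -- the noises: centered Gaussian, independent at different times
    {Ω : Type*} [MeasurableSpace Ω] (P : Measure Ω) [IsProbabilityMeasure P]
    (w : Fin n → ℕ → Ω → Vec m) (wg : ℕ → Ω → Vec m)
    (hw : ∀ i k, HasLaw (w i k) (multivariateGaussian 0 (σ i k ^ 2 • 1)) P)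
    (hwg : ∀ k, HasLaw (wg k) (multivariateGaussian 0 (σg k ^ 2 • 1)) P)
    (hindep : iIndepFun (fun k ω => (wg k ω, fun i => w i k ω)) P)
    -- the iterates of the algorithm
    (γ α : ℕ → ℝ) (hγ_def : γ = powerSeq γ₀ γbar c₁) (hα_def : α = powerSeq α₀ αbar c₂)
    (x : ℕ → Ω → Vec n) (μ : ℕ → Ω → Vec m)
    (hiter : ∀ k ω, (x k ω, μ k ω) =
      iterates X f g γ α x₀ μ₀ (fun i t => w i t ω) (fun t => wg t ω) k) :
    -- mean-square convergence to the unique saddle point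
    (∃ μhat : Vec m,
      IsSaddlePoint X f g xhat μhat ∧
      (∀ x' μ', IsSaddlePoint X f g x' μ' → x' = xhat ∧ μ' = μhat) ∧
      (∀ k, MemLp (x k) 2 P ∧ MemLp (μ k) 2 P) ∧
      Tendsto (fun k => ∫ ω, ‖x k ω - xhat‖ ^ 2 ∂P) atTop (𝓝 0) ∧
      Tendsto (fun k => ∫ ω, ‖μ k ω - μhat‖ ^ 2 ∂P) atTop (𝓝 0)) ∧
    -- when `X` is a product, the agents can carry out their updates separately
    (∀ Y : Fin n → Set ℝ, X = {z | ∀ i, z i ∈ Y i} → ∀ k ω i,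
      x (k + 1) ω i = proj (Y i)
        (agentStep (γ k) (α k) (f i) (x k ω i) (noisyPartial g i (x k ω) (w i k ω)) (μ k ω))) ∧
    -- everything that the cloud releases is differentially private
    (∀ i, IsDiffPrivate P X b ε δ (partialMechanism g i (w i))) ∧
    IsDiffPrivate P X b ε δ (constraintMechanism g wg) ∧
    IsDiffPrivate P X b ε δ (multiplierMechanism g γ α μ₀ wg) := by
  have H : IsConvexProgram f g := ⟨hf_convex, hf_smooth, hg_convex, hg_smooth⟩
  -- With `B ≥ 0` the lower bounds make all standard deviations nonnegative, so `σmax` bounds their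
  -- squares too.
  have hB0 : 0 ≤ B := (hb 0).trans (hB ▸ Finset.le_sup' b (Finset.mem_univ 0))
  have hκ : 0 < kappa δ ε := kappa_pos hε
  have hrun : IsNoisyRun X f g (powerSeq γ₀ γbar c₁) (powerSeq α₀ αbar c₂) x₀ μ₀ σmax P w wg x μ :=
    { start_mem := hx₀
      noise_partial := fun i k =>
        ⟨σ i k, le_trans (by positivity) (hσ i k), hσ_le i k, hw i k⟩
      noise_constraint := fun k => ⟨σg k, le_trans (by positivity) (hσg k), hσg_le k, hwg k⟩
      indep := hindep
      iter := fun k ω => by rw [hiter k ω, hγ_def, hα_def] }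
  have hindw : ∀ i, iIndepFun (w i) P := fun i =>
    hindep.comp (fun _ p => p.2 i) fun _ => by fun_prop
  have hindwg : iIndepFun wg P := hindep.comp (fun _ p => p.1) fun _ => by fun_prop
  have hpriv : IsDiffPrivate P X b ε δ (constraintMechanism g wg) :=
    isDiffPrivate_of_lipschitz hKg hε hδ₀ hδ₁ hb hB hσg hwg hindwg
  refine ⟨?_, ?_, fun i => isDiffPrivate_of_lipschitz (hK i) hε hδ₀ hδ₁ hb hB (hσ i) (hw i)
    (hindw i), hpriv, isDiffPrivate_multiplierMechanism hpriv γ α μ₀⟩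
  · obtain ⟨xs, μhat, hsaddle⟩ := exists_isSaddlePoint H hX_compact hX_convex slater
    obtain rfl : xs = xhat := hsaddle.eq_of_isUniqueConstrainedMin hmin
    have huniq : ∀ x' μ', IsSaddlePoint X f g x' μ' → x' = xs ∧ μ' = μhat := by
      intro x' μ' h'
      rcases hreg with ⟨hint, hreg⟩ | huniq
      · obtain rfl : x' = xs := h'.eq_of_isUniqueConstrainedMin hmin
        exact ⟨rfl, h'.eq_of_isRegularPoint H hsaddle hint hreg⟩
      · exact huniq _ _ _ _ h' hsaddle
    have hmem := hrun.memLp H hX_compact hX_convex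
    have hlim := hrun.tendsto_integral H hX_compact hX_convex slater hγ hα hc₂ hc hc₁ huniq
    have hI1 : ∀ k, Integrable (fun ω => ‖x k ω - xs‖ ^ 2) P := fun k =>
      ((hmem k).1.sub (memLp_const xs)).norm.integrable_sq
    have hI2 : ∀ k, Integrable (fun ω => ‖μ k ω - μhat‖ ^ 2) P := fun k =>
      ((hmem k).2.sub (memLp_const μhat)).norm.integrable_sq
    refine ⟨μhat, hsaddle, huniq, hmem, ?_, ?_⟩
    · refine squeeze_zero (fun k => integral_nonneg fun ω => sq_nonneg _) (fun k => ?_) hlim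
      exact integral_mono (hI1 k) ((hI1 k).add (hI2 k)) fun ω =>
        le_add_of_nonneg_right (sq_nonneg ‖μ k ω - μhat‖)
    · refine squeeze_zero (fun k => integral_nonneg fun ω => sq_nonneg _) (fun k => ?_) hlim
      exact integral_mono (hI2 k) ((hI1 k).add (hI2 k)) fun ω =>
        le_add_of_nonneg_left (sq_nonneg ‖x k ω - xs‖)
  · intro Y hY k ω i
    have hx : x k ω = (iterates X f g γ α x₀ μ₀ (fun i t => w i t ω) (fun t => wg t ω) k).1 :=
      congrArg Prod.fst (hiter k ω)
    have hμ : μ k ω = (iterates X f g γ α x₀ μ₀ (fun i t => w i t ω) (fun t => wg t ω) k).2 :=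
      congrArg Prod.snd (hiter k ω)
    rw [show x (k + 1) ω = _ from congrArg Prod.fst (hiter (k + 1) ω), iterates,
      proj_pi_apply hX_compact ⟨x₀, hx₀⟩ hX_convex hY, hx, hμ]
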